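/- Let $\mathbb T=\mathbb R/2\pi\mathbb Z$, $s\ge 0$, $r\ge 1$, and let $\mathcal L$ be the Fourier multiplier on $\mathbb T^2$ with real symbol $b:\mathbb Z^2\to\mathbb R$, $\widehat{\mathcal L u}(\mathbf k)=b(\mathbf k)\widehat u(\mathbf k)$, where $|b(\mathbf k)|\le C|\mathbf k|^{r-1}$ for all $|\mathbf k|\ge N_0$, for some $C>0$, $N_0\ge 0$. For $\sigma\in\mathbb R$ let $H^\sigma_p(\mathbb T^2)$ be the space of (complex) periodic distributions $u$ with $$\|u\|_{H^\sigma_p}^2=(2\pi)^2\sum_{\mathbf k\in\mathbb Z^2}(1+|\mathbf k|)^{2\sigma}|\widehat u(\mathbf k)|^2<\infty .$$ Let $\psi_{\mathbf k}(\mathbf x)=\frac1{2\pi}e^{i\mathbf k\cdot\mathbf x}$ and assume: (H1) $\partial_x\mathcal L\psi_{\mathbf k}=i\lambda_{\mathbf k}\psi_{\mathbf k}$ with $\lambda_{\mathbf k}=k_1b(\mathbf k)$, for all $\mathbf k=(k_1,k_2)\in\mathbb Z^2$. (H3) For all $(k_1,k_2)\in\mathbb Z^2$, $\lambda_{(-k_1,k_2)}=-\lambda_{(k_1,k_2)}$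 and $\lambda_{(k_1,-k_2)}=\lambda_{(k_1,k_2)}$. If $k_1\ne0$, the integer solutions $j_2$ of $\lambda_{(k_1,j_2)}=\lambda_{(k_1,k_2)}$ are exactly $j_2=\pm k_2$. If $k_2\neq0$, the only integer solution $j_1$ of $\lambda_{(j_1,k_2)}=\lambda_{(k_1,k_2)}$ is $j_1=k_1$. Let $\mathbb I\subset\mathbb Z^2$ be a maximal set such that $\lambda_{\mathbf k}\ne\lambda_{\mathbf k'}$ for all distinct $\mathbf k,\mathbf k'\in\mathbb I$. Suppose that $$\gamma:=\inf_{\mathbf k,\mathbf k'\in\mathbb I,\ \mathbf k\ne\mathbf k'}|\lambda_{\mathbf k}-\lambda_{\mathbf k'}|>0$$ and put $$\gamma':=\sup_{S\subset\mathbb I\text{ finite}}\ \inf_{\mathbf k,\mathbf k'\in\mathbb I\setminus S,\ \mathbf k\ne\mathbf k'}|\lambda_{\mathbf k}-\lambda_{\mathbf k'}|\in(0,\infty].$$ Let $T>2\pi/\gamma'$ (that is, $T>0$ if $\gamma'=\infty$). Then there is a constant $\nu>0$, depending only on $s$, $T$ and the equation (that is, on $b$), for which the following holds. Let $g_1,g_2\in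 C^\infty(\mathbb T)$ be non-negative with $\int_{\mathbb T}g_1=\int_{\mathbb T}g_2=1$, such that $\{g_1>0\}$ and $\{g_2>0\}$ are open intervals of $\mathbb T$, and set $$G\phi(x,y)=g_2(y)\Big(\tfrac1{2\pi}\phi(x,y)-\tfrac1{(2\pi)^2}\int_0^{2\pi}\phi(x',y)\,dx'\Big)+g_1(x)\Big(\tfrac1{2\pi}\phi(x,y)-\tfrac1{(2\pi)^2}\int_0^{2\pi}\phi(x,y')\,dy'\Big).$$ For all $u_0,u_1\in H^s_p(\mathbb T^2)$ with $\widehat{u_0}(0,0)=\widehat{u_1}(0,0)$ there exists $h\in L^2([0,T];H^s_p(\mathbb T^2))$ such that the problem $$u\in C([0,T];H^s_p(\mathbb T^2)),\qquad \partial_tu=\partial_x\mathcal Lu+Gh\ \text{ in }H^{s-r}_p(\mathbb T^2)\text{ on }(0,T),\qquad u(0)=u_0,$$ has a unique solution $u$, and this solution satisfies $u(T)=u_1$. (A solution is understood to be absolutely continuous on $[0,T]$ with values in $H^{s-r}_p(\mathbb T^2)$ and to satisfy the equation for almost every $t\in(0,T)$.) Moreover $$\|h\|_{L^2([0,T];H^s_p(\mathbb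 T^2))}\le\nu\left(\|u_0\|_{H^s_p(\mathbb T^2)}+\|u_1\|_{H^s_p(\mathbb T^2)}\right).$$ -/

import Mathlib

open MeasureTheory Set
open scoped Real ENNReal ContDiff

noncomputable section

namespace TorusControl

/-! ### The two-dimensional torus and Fourier series -/

instance factTwoPiPos : Fact (0 < 2 * π) := ⟨Real.two_pi_pos⟩

/-- The one-dimensional torus `ℝ / 2πℤ`; its `volume` has total mass `2π`. -/
abbrev Torus : Type := AddCircle (2 * π)

/-- The Euclidean length `|k| = √(k₁² + k₂²)`. -/
def len (k : ℤ × ℤ) : ℝ := Real.sqrt ((k.1 : ℝ) ^ 2 + (k.2 : ℝ) ^ 2)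

/-- `ψ_k(x, y) = (2π)⁻¹ e^{i(k₁ x + k₂ y)}`. -/
def psi (k : ℤ × ℤ) : C(Torus × Torus, ℂ) where
  toFun p := (1 / (2 * π) : ℂ) * (fourier k.1 p.1 * fourier k.2 p.2)
  continuous_toFun := by fun_prop

/-- The Fourier coefficients `(2π)⁻² ∫ e^{-i k·x} f(x) dx` of a function on the 2-torus. -/
def fourierCoef (f : Torus × Torus → ℂ) (k : ℤ × ℤ) : ℂ :=
  (1 / (2 * π) ^ 2 : ℂ) * ∫ p : Torus × Torus, fourier (-k.1) p.1 * fourier (-k.2) p.2 * f p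

/-! ### Periodic Sobolev spaces

A periodic distribution on the 2-torus is given by its Fourier coefficients (the Fourier transform
is a linear bijection from distributions onto sequences of slow growth), and `H^s`, `s ∈ ℝ`,
consists of those with `∑ (1 + |k|)^{2s} |û(k)|² < ∞`. -/

/-- The weight `2π (1 + |k|)^s`. -/
def weight (s : ℝ) (k : ℤ × ℤ) : ℝ := 2 * π * (1 + len k) ^ s

lemma one_add_len_pos (k : ℤ × ℤ) : 0 < 1 + len k := by
  have : 0 ≤ len k := Real.sqrt_nonneg _
  linarith

lemma weight_pos (s : ℝ) (k : ℤ × ℤ) : 0 < weight s k :=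
  mul_pos Real.two_pi_pos (Real.rpow_pos_of_pos (one_add_len_pos k) s)

lemma norm_weighted_sq (s : ℝ) (u : ℤ × ℤ → ℂ) (k : ℤ × ℤ) :
    ‖(weight s k : ℂ) * u k‖ ^ 2 = (2 * π) ^ 2 * ((1 + len k) ^ (2 * s) * ‖u k‖ ^ 2) := by
  rw [norm_mul, Complex.norm_real, Real.norm_of_nonneg (weight_pos s k).le, weight, mul_comm 2 s,
    Real.rpow_mul (one_add_len_pos k).le, Real.rpow_two]
  ring

lemma summable_iff_memlp (s : ℝ) (u : ℤ × ℤ → ℂ) :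
    Summable (fun k => (1 + len k) ^ (2 * s) * ‖u k‖ ^ 2) ↔
      Memℓp (fun k => (weight s k : ℂ) * u k) 2 := by
  rw [memℓp_gen_iff (by norm_num)]
  have h : ∀ k, ‖(weight s k : ℂ) * u k‖ ^ (2 : ℝ≥0∞).toReal
      = (2 * π) ^ 2 * ((1 + len k) ^ (2 * s) * ‖u k‖ ^ 2) := by
    intro k
    rw [← norm_weighted_sq, ENNReal.toReal_ofNat, Real.rpow_two]
  simp_rw [h]
  exact (summable_mul_left_iff (by positivity)).symm

/-- The coefficient families `û` with `∑ (1 + |k|)^{2s} |û(k)|² < ∞`. -/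
def sobolevSubmodule (s : ℝ) : Submodule ℂ (ℤ × ℤ → ℂ) where
  carrier := {u | Summable (fun k => (1 + len k) ^ (2 * s) * ‖u k‖ ^ 2)}
  zero_mem' := by simp [summable_zero]
  add_mem' := by
    intro u v hu hv
    simp only [mem_ofPred_eq, summable_iff_memlp] at *
    convert hu.add hv using 1
    ext k
    simp [mul_add]
  smul_mem' := by
    intro c u hu
    simp only [mem_ofPred_eq, summable_iff_memlp] at *
    convert hu.const_smul c using 1
    ext k
    simp [mul_left_comm]

/-- The periodic Sobolev space `H^s` on the 2-torus, `s ∈ ℝ`. -/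
def Sobolev (s : ℝ) : Type := ↥(sobolevSubmodule s)

namespace Sobolev

variable {s : ℝ}

instance : AddCommGroup (Sobolev s) := inferInstanceAs (AddCommGroup ↥(sobolevSubmodule s))

instance : Module ℂ (Sobolev s) := inferInstanceAs (Module ℂ ↥(sobolevSubmodule s))

/-- The Fourier coefficients of an element of `H^s`. -/
def coeff (u : Sobolev s) : ℤ × ℤ → ℂ := u.1

/-- `û ↦ (2π (1 + |k|)^s û(k))_k`, as a linear map from `H^s` to `ℓ²`. -/
def toEll (s : ℝ) : Sobolev s →ₗ[ℂ] lp (fun _ : ℤ × ℤ => ℂ) 2 where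
  toFun u := ⟨fun k => (weight s k : ℂ) * u.coeff k, (summable_iff_memlp s u.coeff).1 u.2⟩
  map_add' u v := by
    ext k
    exact mul_add _ _ _
  map_smul' c u := by
    ext k
    exact mul_left_comm _ _ _

lemma toEll_injective (s : ℝ) : Function.Injective (toEll s) := by
  intro u v h
  apply Subtype.ext
  funext k
  have hk : (weight s k : ℂ) * u.coeff k = (weight s k : ℂ) * v.coeff k :=
    congrFun (congrArg Subtype.val h) k
  exact mul_left_cancel₀ (Complex.ofReal_ne_zero.2 (weight_pos s k).ne') hk

/-- The norm of `H^s`; see `norm_sq_eq` for the formula. -/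
instance : NormedAddCommGroup (Sobolev s) :=
  NormedAddCommGroup.induced (Sobolev s) (lp (fun _ : ℤ × ℤ => ℂ) 2) (toEll s) (toEll_injective s)

instance : NormedSpace ℂ (Sobolev s) :=
  NormedSpace.induced ℂ (Sobolev s) (lp (fun _ : ℤ × ℤ => ℂ) 2) (toEll s)

/-- `‖u‖² = (2π)² ∑ (1 + |k|)^{2s} |û(k)|²`. -/
lemma norm_sq_eq (u : Sobolev s) :
    ‖u‖ ^ 2 = (2 * π) ^ 2 * ∑' k, (1 + len k) ^ (2 * s) * ‖u.coeff k‖ ^ 2 := by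
  have h := lp.norm_rpow_eq_tsum (p := 2) (by norm_num) (toEll s u)
  rw [ENNReal.toReal_ofNat, Real.rpow_two] at h
  rw [← tsum_mul_left]
  refine h.trans (tsum_congr fun k => ?_)
  rw [Real.rpow_two]
  exact norm_weighted_sq s u.coeff k

/-- The inclusion `H^s ⊆ H^{s'}` for `s' ≤ s`. -/
def incl {s s' : ℝ} (h : s' ≤ s) (u : Sobolev s) : Sobolev s' :=
  ⟨u.coeff, by
    refine Summable.of_nonneg_of_le (fun k => ?_) (fun k => ?_) u.2
    · exact mul_nonneg (Real.rpow_nonneg (one_add_len_pos k).le _) (sq_nonneg _)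
    · have h1 : 1 ≤ 1 + len k := le_add_of_nonneg_right (Real.sqrt_nonneg _)
      exact mul_le_mul_of_nonneg_right
        (Real.rpow_le_rpow_of_exponent_le h1 (by linarith)) (sq_nonneg _)⟩

/-- The square-integrable function `2π ∑ û(k) ψ_k` on the torus represented by an element of `H^s`,
`s ≥ 0` (the series converges in `L²`, see `hasSum_toL2`). -/
def toL2 (u : Sobolev s) : Lp ℂ 2 (volume : Measure (Torus × Torus)) :=
  ∑' k, (2 * π * u.coeff k : ℂ) • ContinuousMap.toLp 2 volume ℂ (psi k)

end Sobolev

/-- `∂ₓ` on Fourier coefficients. -/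
def derivX (a : ℤ × ℤ → ℂ) : ℤ × ℤ → ℂ := fun k => Complex.I * k.1 * a k

/-- The Fourier multiplier with symbol `b`, on Fourier coefficients. -/
def multiplier (b : ℤ × ℤ → ℝ) (a : ℤ × ℤ → ℂ) : ℤ × ℤ → ℂ := fun k => b k * a k

/-! ### Basic facts: the functions `ψ_k` are orthonormal -/

lemma integral_fourier (n : ℤ) :
    ∫ x : Torus, (fourier n x : ℂ) = if n = 0 then (2 * π : ℂ) else 0 := by
  split_ifs with h
  · subst h
    simp only [fourier_zero, integral_const, Measure.real, AddCircle.measure_univ]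
    rw [ENNReal.toReal_ofReal Real.two_pi_pos.le]
    simp
  · exact integral_eq_zero_of_add_right_eq_neg (μ := volume)
      (fourier_add_half_inv_index h Real.two_pi_pos)

lemma fourierCoef_psi (j k : ℤ × ℤ) :
    fourierCoef (psi j) k = if j = k then (1 / (2 * π) : ℂ) else 0 := by
  have hpi : (π : ℂ) ≠ 0 := Complex.ofReal_ne_zero.2 Real.pi_ne_zero
  have h : ∀ p : Torus × Torus, fourier (-k.1) p.1 * fourier (-k.2) p.2 * psi j p
      = (1 / (2 * π) : ℂ) * (fourier (j.1 - k.1) p.1 * fourier (j.2 - k.2) p.2) := by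
    intro p
    simp only [psi, ContinuousMap.coe_mk, sub_eq_add_neg, fourier_add]
    ring
  unfold fourierCoef
  simp_rw [h]
  rw [integral_const_mul, Measure.volume_eq_prod,
    integral_prod_mul (fun x : Torus => (fourier (j.1 - k.1) x : ℂ))
      (fun y : Torus => (fourier (j.2 - k.2) y : ℂ)), integral_fourier, integral_fourier]
  simp only [sub_eq_zero, Prod.ext_iff]
  by_cases h1 : j.1 = k.1 <;> by_cases h2 : j.2 = k.2 <;> simp [h1, h2]
  field_simp

lemma inner_psi (k : ℤ × ℤ) (f : Lp ℂ 2 (volume : Measure (Torus × Torus))) :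
    inner ℂ (ContinuousMap.toLp 2 volume ℂ (psi k)) f = 2 * π * fourierCoef f k := by
  have hpi : (π : ℂ) ≠ 0 := Complex.ofReal_ne_zero.2 Real.pi_ne_zero
  rw [L2.inner_def, fourierCoef, ← mul_assoc, ← integral_const_mul]
  refine integral_congr_ae ?_
  filter_upwards [ContinuousMap.coeFn_toLp (p := 2) (𝕜 := ℂ) volume (psi k)] with p hp
  rw [hp]
  simp only [RCLike.inner_apply, psi, ContinuousMap.coe_mk, map_mul, fourier_neg, map_div₀,
    map_one, Complex.conj_ofReal, map_ofNat]
  field_simp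

lemma orthonormal_psi :
    Orthonormal ℂ (fun k : ℤ × ℤ =>
      (ContinuousMap.toLp 2 volume ℂ (psi k) : Lp ℂ 2 (volume : Measure (Torus × Torus)))) := by
  classical
  have hpi : (π : ℂ) ≠ 0 := Complex.ofReal_ne_zero.2 Real.pi_ne_zero
  rw [orthonormal_iff_ite]
  intro j k
  have hc : fourierCoef (ContinuousMap.toLp 2 volume ℂ (psi k) :
      Lp ℂ 2 (volume : Measure (Torus × Torus))) j = fourierCoef (psi k) j := by
    unfold fourierCoef
    congr 1
    refine integral_congr_ae ?_
    filter_upwards [ContinuousMap.coeFn_toLp (p := 2) (𝕜 := ℂ) volume (psi k)] with p hp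
    rw [hp]
  rw [inner_psi, hc, fourierCoef_psi]
  simp only [eq_comm (a := k)]
  split_ifs
  · field_simp
  · simp

/-- For `s ≥ 0` the series defining `toL2` converges in `L²`. -/
lemma hasSum_toL2 {s : ℝ} (hs : 0 ≤ s) (u : Sobolev s) :
    HasSum (fun k => (2 * π * u.coeff k : ℂ) •
      (ContinuousMap.toLp 2 volume ℂ (psi k) : Lp ℂ 2 (volume : Measure (Torus × Torus))))
      u.toL2 := by
  refine Summable.hasSum ?_
  have h0 : Memℓp (fun k => (2 * π * u.coeff k : ℂ)) 2 := by
    have h := (summable_iff_memlp 0 _).1 (u.incl hs).2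
    have hc : (u.incl hs).1 = u.coeff := rfl
    simpa [weight, hc] using h
  exact (orthonormal_psi.orthogonalFamily.summable_of_lp ⟨_, h0⟩)

/-- For `s ≥ 0` the function `u.toL2` has Fourier coefficients `û`. -/
lemma fourierCoef_toL2 {s : ℝ} (hs : 0 ≤ s) (u : Sobolev s) : fourierCoef u.toL2 = u.coeff := by
  classical
  have hpi : (π : ℂ) ≠ 0 := Complex.ofReal_ne_zero.2 Real.pi_ne_zero
  funext k
  have h := (hasSum_toL2 hs u).mapL (innerSL ℂ (ContinuousMap.toLp 2 volume ℂ (psi k) :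
    Lp ℂ 2 (volume : Measure (Torus × Torus))))
  simp only [innerSL_apply_apply, inner_smul_right,
    orthonormal_iff_ite.1 orthonormal_psi k, mul_ite, mul_one, mul_zero] at h
  have h1 := hasSum_single (f := fun j => if k = j then (2 * π * u.coeff j : ℂ) else 0) k
    (fun j hj => if_neg (Ne.symm hj))
  have h2 := h.unique h1
  simp only [if_true] at h2
  rw [inner_psi] at h2
  exact mul_left_cancel₀ (by simp [hpi]) h2

/-! ### The control operator -/

/-- A control profile: a non-negative smooth function on the torus with integral one which is
positive exactly on an open interval `ω ⊆ 𝕋` (so that its support is the closure of `ω`). -/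
structure IsProfile (g : Torus → ℝ) : Prop where
  smooth : ContDiff ℝ ∞ (fun x : ℝ => g (x : Torus))
  nonneg : ∀ x, 0 ≤ g x
  integral_eq_one : ∫ x, g x = 1
  pos_on_interval : ∃ a c : ℝ, a < c ∧ c ≤ a + 2 * π ∧
    {x | 0 < g x} = (fun x : ℝ => (x : Torus)) '' Ioo a c

/-- `G₁ φ (x, y) = φ(x, y) / 2π - (2π)⁻² ∫ φ(x', y) dx'`. -/
def opG1 (φ : Torus × Torus → ℂ) (p : Torus × Torus) : ℂ :=
  (1 / (2 * π) : ℂ) * φ p - (1 / (2 * π) ^ 2 : ℂ) * ∫ x' : Torus, φ (x', p.2)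

/-- `G₂ φ (x, y) = φ(x, y) / 2π - (2π)⁻² ∫ φ(x, y') dy'`. -/
def opG2 (φ : Torus × Torus → ℂ) (p : Torus × Torus) : ℂ :=
  (1 / (2 * π) : ℂ) * φ p - (1 / (2 * π) ^ 2 : ℂ) * ∫ y' : Torus, φ (p.1, y')

/-- `G φ (x, y) = g₂(y) G₁ φ (x, y) + g₁(x) G₂ φ (x, y)`. -/
def opG (g₁ g₂ : Torus → ℝ) (φ : Torus × Torus → ℂ) (p : Torus × Torus) : ℂ :=
  g₂ p.2 * opG1 φ p + g₁ p.1 * opG2 φ p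

/-! ### The equation -/

/-- `u` solves `∂ₜ u = ∂ₓ L u + G h` on `(0, T)`, `u(0) = u₀`, where `L` has symbol `b`:
`u ∈ C([0, T]; H^s)`, `u` is absolutely continuous with values in `H^{s-r}`, and the equation holds
in `H^{s-r}` (as an equality of all Fourier coefficients) for almost every `t ∈ (0, T)`, since
`h ∈ L²(0, T; H^s)` is only defined almost everywhere in time. -/
structure IsSolution (b : ℤ × ℤ → ℝ) (g₁ g₂ : Torus → ℝ) {s r : ℝ} (hr : 1 ≤ r) (T : ℝ)
    (u₀ : Sobolev s) (h u : ℝ → Sobolev s) : Prop where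
  continuousOn : ContinuousOn u (Icc 0 T)
  initial : u 0 = u₀
  absolutelyContinuous : AbsolutelyContinuousOnInterval
    (fun t => (u t).incl (sub_le_self s (zero_le_one.trans hr))) 0 T
  equation : ∀ᵐ t ∂(volume.restrict (Ioo 0 T)), ∃ d : Sobolev (s - r),
    HasDerivAt (fun τ => (u τ).incl (sub_le_self s (zero_le_one.trans hr))) d t ∧
    d.coeff = derivX (multiplier b (u t).coeff) + fourierCoef (opG g₁ g₂ (h t).toL2)

/-! ### Hypotheses on the symbol and on the eigenvalues -/

/-- The multiplier with symbol `b` has order `r - 1`: `|b(k)| ≤ C |k|^{r-1}` for large `|k|`. -/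
def HasOrder (b : ℤ × ℤ → ℝ) (r : ℝ) : Prop :=
  ∃ C > 0, ∃ N₀ ≥ 0, ∀ k : ℤ × ℤ, N₀ ≤ len k → |b k| ≤ C * len k ^ (r - 1)

/-- `∂ₓ L ψ_k = i λ_k ψ_k` with `λ_k = k₁ b(k)`, for all `k`. -/
def EigenvalueHyp (b lam : ℤ × ℤ → ℝ) : Prop :=
  ∀ k : ℤ × ℤ, lam k = k.1 * b k ∧
    derivX (multiplier b (fourierCoef (psi k))) = (Complex.I * lam k) • fourierCoef (psi k)

/-- The identity `∂ₓ L ψ_k = i λ_k ψ_k` holds for every symbol, with `λ_k = k₁ b(k)`. -/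
lemma eigenvalueHyp (b : ℤ × ℤ → ℝ) : EigenvalueHyp b (fun k => k.1 * b k) := by
  refine fun k => ⟨rfl, ?_⟩
  funext j
  by_cases h : k = j
  · subst h
    simp only [derivX, multiplier, Pi.smul_apply, smul_eq_mul]
    push_cast
    ring
  · simp [derivX, multiplier, fourierCoef_psi, h]

/-- `λ` is odd in `k₁` and even in `k₂`; for `k₁ ≠ 0` the integer solutions of
`λ(k₁, j₂) = λ(k₁, k₂)` are exactly `j₂ = ± k₂`; for `k₂ ≠ 0` the only integer solution of
`λ(j₁, k₂) = λ(k₁, k₂)` is `j₁ = k₁`. -/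
structure OddEvenHyp (lam : ℤ × ℤ → ℝ) : Prop where
  odd_fst : ∀ k₁ k₂ : ℤ, lam (-k₁, k₂) = -lam (k₁, k₂)
  even_snd : ∀ k₁ k₂ : ℤ, lam (k₁, -k₂) = lam (k₁, k₂)
  unique_snd : ∀ k₁ k₂ : ℤ, k₁ ≠ 0 → ∀ j₂ : ℤ,
    lam (k₁, j₂) = lam (k₁, k₂) ↔ j₂ = k₂ ∨ j₂ = -k₂
  unique_fst : ∀ k₁ k₂ : ℤ, k₂ ≠ 0 → ∀ j₁ : ℤ, lam (j₁, k₂) = lam (k₁, k₂) ↔ j₁ = k₁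

/-- A maximal set of indices with pairwise distinct eigenvalues. -/
def IsMaximalDistinct (lam : ℤ × ℤ → ℝ) (A : Set (ℤ × ℤ)) : Prop :=
  Maximal (fun B : Set (ℤ × ℤ) => InjOn lam B) A

/-- `inf |λ_k - λ_{k'}|` over distinct `k, k' ∈ A`, in `[0, ∞]`. -/
def gap (lam : ℤ × ℤ → ℝ) (A : Set (ℤ × ℤ)) : ℝ≥0∞ :=
  ⨅ (k ∈ A) (k' ∈ A) (_ : k ≠ k'), ENNReal.ofReal |lam k - lam k'|

/-- `γ'`, the supremum over all finite `S ⊆ A` of the gap of `A \ S`; it may be `∞`. -/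
def asymptoticGap (lam : ℤ × ℤ → ℝ) (A : Set (ℤ × ℤ)) : ℝ≥0∞ :=
  ⨆ (S : Set (ℤ × ℤ)) (_ : S ⊆ A) (_ : S.Finite), gap lam (A \ S)

end TorusControl

end

open TorusControl

/-! The proof is the moment method. In Fourier coefficients, `u T = u₁` means that for every `k` the
integral of `e^{-iλ_k t} (Gh)^(t,k)` over `[0,T]` equals `z_k = e^{-iλ_k T} û₁(k) - û₀(k)`. The
control is sought as `ĥ(t,j) = Q_j(t) v_j`, where `Q_j` depends only on the eigenvalue `λ_j` and the
`Q_j` are biorthogonal to the exponentials. Integrating `h` against `e^{-iλ_k t}` then yields the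
projection of `v` onto the eigenspace of `λ_k` (`coeff_integral_biorthogonal`).

The operator `G` couples `k` only with indices sharing a coordinate with it. Inside one eigenspace,
the hypotheses on `λ` leave just `k` and `(k₁,-k₂)` (`fourierCoef_opG_of_eigen`). So `v` solves
systems of size at most two. Off the axes these have diagonal `2` and off-diagonal entries of
modulus at most `1`, because `g₂` is non-negative with integral one. They are therefore inverted
with a bound free of `g₁, g₂` (`exists_block_inverse`). The index `(0,0)` is never controlled, and
there `z` vanishes by assumption.

The functions `Q_j` come from `exists_uniform_biorthogonal`. For frequencies with gap `g` and `g τ >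
2π`, the Gram matrix of exponentials weighted by a half-period sine is strictly diagonally dominant,
and a Neumann series in `ℓ¹` gives a bounded dual family (`exists_biorthogonal_of_separated`).
Frequencies violating the large gap `g` are bounded in number around each `μ`. They are annihilated
one at a time by subtracting a moving average over a short window, which uses up the spare time `T -
τ`; the small gap `γ` keeps the normalising factors away from zero. -/

noncomputable section

namespace TorusControl

/-! ### Transforms of compactly supported functions of time -/

/-- `∫ q(t) e^{-iξt} dt`. -/
def expTransform (q : ℝ → ℂ) (ξ : ℝ) : ℂ := ∫ t : ℝ, q t * Complex.exp (-(Complex.I * ξ * t))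

lemma norm_exp_neg_I_mul (ξ t : ℝ) : ‖Complex.exp (-(Complex.I * ξ * t))‖ = 1 := by
  have : -(Complex.I * ξ * t) = ((-(ξ * t) : ℝ) : ℂ) * Complex.I := by push_cast; ring
  rw [this, Complex.norm_exp_ofReal_mul_I]

/-- Continuous functions supported in `[0, τ]` and bounded by `M`. -/
structure IsControlShape (τ M : ℝ) (q : ℝ → ℂ) : Prop where
  continuous : Continuous q
  support : ∀ t, t ∉ Icc 0 τ → q t = 0
  bound : ∀ t, ‖q t‖ ≤ M

namespace IsControlShape

variable {τ M : ℝ} {q : ℝ → ℂ}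

lemma mono (hq : IsControlShape τ M q) {τ' M' : ℝ} (hτ : τ ≤ τ') (hM : M ≤ M') :
    IsControlShape τ' M' q :=
  ⟨hq.continuous, fun t ht => hq.support t fun h => ht ⟨h.1, h.2.trans hτ⟩,
    fun t => (hq.bound t).trans hM⟩

lemma const_mul (hq : IsControlShape τ M q) (c : ℂ) :
    IsControlShape τ (‖c‖ * M) (fun t => c * q t) :=
  ⟨continuous_const.mul hq.continuous, fun t ht => by simp [hq.support t ht], fun t => by
    rw [norm_mul]; exact mul_le_mul_of_nonneg_left (hq.bound t) (norm_nonneg _)⟩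

end IsControlShape

lemma expTransform_const_mul (c : ℂ) (q : ℝ → ℂ) (ξ : ℝ) :
    expTransform (fun t => c * q t) ξ = c * expTransform q ξ := by
  simp only [expTransform, mul_assoc]
  exact integral_const_mul _ _

lemma integral_eq_intervalIntegral_of_support {E : Type*} [NormedAddCommGroup E] [NormedSpace ℝ E]
    {τ : ℝ} (hτ : 0 ≤ τ) {f : ℝ → E} (hf : ∀ t, t ∉ Icc 0 τ → f t = 0) :
    ∫ t, f t = ∫ t in (0 : ℝ)..τ, f t := by
  rw [intervalIntegral.integral_of_le hτ, ← integral_Icc_eq_integral_Ioc]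
  exact (setIntegral_eq_integral_of_forall_compl_eq_zero hf).symm

/-! ### The sine bump -/

/-- `sin (π t / τ)` on `[0, τ]`, extended by zero. -/
def sineBump (τ t : ℝ) : ℂ := (Real.sin (π / τ * max 0 (min t τ)) : ℝ)

lemma isControlShape_sineBump {τ : ℝ} (hτ : 0 < τ) : IsControlShape τ 1 (sineBump τ) := by
  refine ⟨by unfold sineBump; fun_prop, fun t ht => ?_, fun t => ?_⟩
  · rw [mem_Icc, not_and_or, not_le, not_le] at ht
    rcases ht with h | h
    · simp [sineBump, min_eq_left (h.le.trans hτ.le), max_eq_left h.le]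
    · simp [sineBump, min_eq_right h.le, max_eq_right hτ.le, div_mul_cancel₀ _ hτ.ne']
  · rw [sineBump, Complex.norm_real]
    exact Real.abs_sin_le_one _

/-- The integrand has an explicit antiderivative. The bump vanishes at both ends of its support, so
the transform decays quadratically, which makes the Gram rows summable. At the excluded points `ξ =
±π/τ` the quotient is `0/0`. -/
lemma expTransform_sineBump {τ ξ : ℝ} (hτ : 0 < τ) (hξ : ξ ^ 2 ≠ (π / τ) ^ 2) :
    expTransform (sineBump τ) ξ
      = (π / τ : ℝ) * (1 + Complex.exp (-(Complex.I * ξ * τ))) / ((π / τ : ℝ) ^ 2 - (ξ : ℂ) ^ 2) := by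
  set a : ℝ := π / τ with ha
  have hD : ((a : ℂ) ^ 2 - (ξ : ℂ) ^ 2) ≠ 0 := by
    intro h
    apply hξ
    have h' : ((a ^ 2 - ξ ^ 2 : ℝ) : ℂ) = 0 := by push_cast; exact h
    have := Complex.ofReal_eq_zero.1 h'
    linarith
  have haτ : a * τ = π := div_mul_cancel₀ _ hτ.ne'
  unfold expTransform
  rw [integral_eq_intervalIntegral_of_support hτ.le
    (fun t ht => by rw [(isControlShape_sineBump hτ).support t ht, zero_mul])]
  have hcongr : ∀ t ∈ uIcc 0 τ, sineBump τ t * Complex.exp (-(Complex.I * ξ * t))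
      = Complex.sin (a * t) * Complex.exp (-(Complex.I * ξ * t)) := by
    intro t ht
    rw [uIcc_of_le hτ.le] at ht
    rw [sineBump, min_eq_left ht.2, max_eq_right ht.1, ← ha]
    push_cast
    rfl
  rw [intervalIntegral.integral_congr hcongr]
  have hderiv : ∀ t ∈ uIcc 0 τ, HasDerivAt (fun t : ℝ => Complex.exp (-(Complex.I * ξ * t)) *
      (-(Complex.I * ξ) * Complex.sin (a * t) - a * Complex.cos (a * t)) / ((a : ℂ) ^ 2 - (ξ : ℂ) ^ 2))
      (Complex.sin (a * t) * Complex.exp (-(Complex.I * ξ * t))) t := by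
    intro t _
    have h0 : HasDerivAt (fun t : ℝ => (t : ℂ)) 1 t := Complex.ofRealCLM.hasDerivAt
    have he : HasDerivAt (fun t : ℝ => Complex.exp (-(Complex.I * ξ * t)))
        (Complex.exp (-(Complex.I * ξ * t)) * -(Complex.I * ξ * 1)) t :=
      ((h0.const_mul (Complex.I * ξ)).neg).cexp
    have hs : HasDerivAt (fun t : ℝ => Complex.sin (a * t)) (Complex.cos (a * t) * (a * 1)) t :=
      (((hasDerivAt_id (t : ℂ)).const_mul (a : ℂ)).csin).comp_ofReal
    have hc : HasDerivAt (fun t : ℝ => Complex.cos (a * t)) (-Complex.sin (a * t) * (a * 1)) t :=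
      (((hasDerivAt_id (t : ℂ)).const_mul (a : ℂ)).ccos).comp_ofReal
    have h := (he.mul ((hs.const_mul (-(Complex.I * ξ))).sub (hc.const_mul (a : ℂ)))).div_const
      ((a : ℂ) ^ 2 - (ξ : ℂ) ^ 2)
    refine h.congr_deriv ?_
    simp only [Pi.sub_apply]
    rw [div_eq_iff hD]
    linear_combination (Complex.exp (-(Complex.I * ξ * t)) * ξ ^ 2 * Complex.sin (a * t)) *
      Complex.I_sq
  rw [intervalIntegral.integral_eq_sub_of_hasDerivAt hderiv
    (by apply Continuous.intervalIntegrable; fun_prop)]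
  have haτ' : (a : ℂ) * τ = π := by exact_mod_cast haτ
  simp only [haτ', Complex.sin_pi, Complex.cos_pi, Complex.ofReal_zero, mul_zero, Complex.sin_zero,
    Complex.cos_zero, neg_zero, Complex.exp_zero]
  field_simp
  ring

lemma expTransform_sineBump_zero {τ : ℝ} (hτ : 0 < τ) :
    expTransform (sineBump τ) 0 = (2 / (π / τ) : ℝ) := by
  have h : (π / τ) ≠ 0 := (div_pos Real.pi_pos hτ).ne'
  rw [expTransform_sineBump hτ (by rw [zero_pow two_ne_zero]; exact (pow_ne_zero 2 h).symm)]
  have h' : ((π / τ : ℝ) : ℂ) ≠ 0 := Complex.ofReal_ne_zero.2 h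
  generalize ((π / τ : ℝ)) = a at *
  simp
  field_simp
  norm_num

lemma norm_expTransform_sineBump_le {τ ξ : ℝ} (hτ : 0 < τ) (hξ : π / τ < |ξ|) :
    ‖expTransform (sineBump τ) ξ / expTransform (sineBump τ) 0‖
      ≤ 1 / ((ξ / (π / τ)) ^ 2 - 1) := by
  have ha : 0 < π / τ := div_pos Real.pi_pos hτ
  have h2 : (π / τ) ^ 2 < ξ ^ 2 := by
    rw [← sq_abs ξ]; exact pow_lt_pow_left₀ hξ ha.le two_ne_zero
  rw [expTransform_sineBump_zero hτ, expTransform_sineBump hτ h2.ne']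
  generalize π / τ = a at *
  have hD : ‖(a : ℂ) ^ 2 - (ξ : ℂ) ^ 2‖ = ξ ^ 2 - a ^ 2 := by
    rw [← Complex.ofReal_pow, ← Complex.ofReal_pow, ← Complex.ofReal_sub, Complex.norm_real,
      Real.norm_eq_abs, abs_of_neg (by linarith)]
    ring
  have hn : ‖1 + Complex.exp (-(Complex.I * ξ * τ))‖ ≤ 2 := by
    refine (norm_add_le _ _).trans ?_
    rw [norm_exp_neg_I_mul, norm_one]; norm_num
  have hpos : 0 < ξ ^ 2 - a ^ 2 := by linarith
  rw [norm_div, norm_div, norm_mul, hD, Complex.norm_real, Complex.norm_real, Real.norm_of_nonneg ha.le,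
    Real.norm_of_nonneg (by positivity : 0 ≤ 2 / a)]
  calc a * ‖1 + Complex.exp (-(Complex.I * ξ * τ))‖ / (ξ ^ 2 - a ^ 2) / (2 / a)
      ≤ a * 2 / (ξ ^ 2 - a ^ 2) / (2 / a) := by gcongr
    _ = 1 / ((ξ / a) ^ 2 - 1) := by
        have : (ξ / a) ^ 2 - 1 = (ξ ^ 2 - a ^ 2) / a ^ 2 := by field_simp
        rw [this]
        field_simp

/-! ### A telescoping sum over the integers -/

/-- `1 / (4n² - 1)`, with the value `0` at `n = 0`. -/
def oddRecip (n : ℤ) : ℝ := if n = 0 then 0 else 1 / (4 * (n : ℝ) ^ 2 - 1)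

lemma oddRecip_nonneg (n : ℤ) : 0 ≤ oddRecip n := by
  unfold oddRecip
  split_ifs with h
  · exact le_rfl
  · have h1 : (1 : ℝ) ≤ (n : ℝ) ^ 2 := by
      have : (1 : ℤ) ≤ n ^ 2 := Int.one_le_abs (pow_ne_zero 2 h) |>.trans_eq (abs_of_nonneg (sq_nonneg n))
      exact_mod_cast this
    exact div_nonneg zero_le_one (by linarith)

/-- Partial fractions, `1/(4n² - 1) = ½ (1/(2n-1) - 1/(2n+1))`, make the partial sums telescope. -/
lemma hasSum_oddRecip_succ : HasSum (fun n : ℕ => oddRecip ((n : ℤ) + 1)) (1 / 2) := by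
  rw [hasSum_iff_tendsto_nat_of_nonneg (fun n => oddRecip_nonneg _)]
  have h : ∀ N : ℕ, ∑ n ∈ Finset.range N, oddRecip ((n : ℤ) + 1)
      = 1 / 2 - 1 / 2 * (1 / (2 * (N : ℝ) + 1)) := by
    intro N
    induction N with
    | zero => simp
    | succ N ih =>
      rw [Finset.sum_range_succ, ih, oddRecip, if_neg (by positivity)]
      push_cast
      have h1 : (2 * (N : ℝ) + 1) ≠ 0 := by positivity
      have h2 : (2 * ((N : ℝ) + 1) + 1) ≠ 0 := by positivity
      have h3 : 4 * ((N : ℝ) + 1) ^ 2 - 1 = (2 * N + 1) * (2 * (N + 1) + 1) := by ring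
      rw [h3]
      field_simp
      ring
  simp_rw [h]
  have h1 : Filter.Tendsto (fun N : ℕ => 1 / (2 * (N : ℝ) + 1)) Filter.atTop (nhds 0) := by
    refine Filter.Tendsto.const_div_atTop ?_ 1
    exact Filter.tendsto_atTop_add_const_right _ _
      (tendsto_natCast_atTop_atTop.const_mul_atTop two_pos)
  simpa only [mul_zero, sub_zero] using (h1.const_mul (1 / 2)).const_sub (1 / 2 : ℝ)

/-- The total being exactly `1` is what makes `g τ > 2π` suffice for diagonal dominance. -/
lemma hasSum_oddRecip : HasSum oddRecip 1 := by
  have h1 : HasSum (fun n : ℕ => oddRecip (n : ℤ)) (1 / 2) := by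
    rw [← hasSum_nat_add_iff' 1]
    simpa [oddRecip] using hasSum_oddRecip_succ
  have h2 : HasSum (fun n : ℕ => oddRecip (-((n : ℤ) + 1))) (1 / 2) := by
    convert hasSum_oddRecip_succ using 2 with n
    have h : (n : ℤ) + 1 ≠ 0 := by positivity
    have h' : -((n : ℤ) + 1) ≠ 0 := neg_ne_zero.2 h
    rw [oddRecip, oddRecip, if_neg h, if_neg h']
    push_cast
    ring
  have := h1.of_nat_of_neg_add_one h2
  norm_num at this
  exact this

/-! ### Separated sets of frequencies -/

/-- Distinct elements of `A` have distance at least `g`. -/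
def IsSeparatedBy (A : Set ℝ) (g : ℝ) : Prop := A.Pairwise fun x y => g ≤ |x - y|

/-- The signed number of steps of length `g` from `μ` to `x`, rounded towards zero. -/
def stepIndex (g μ x : ℝ) : ℤ := if μ ≤ x then ⌊(x - μ) / g⌋ else -⌊(μ - x) / g⌋

/-- On one side of `μ`, equal floors force a distance below `g`. On opposite sides the indices
cannot meet, since a point of `A` left of `μ` is at least one full step away. Sums over `A` are thus
dominated by sums over `ℤ`. -/
lemma stepIndex_injOn {A : Set ℝ} {g μ : ℝ} (hg : 0 < g) (hA : IsSeparatedBy A g) (hμ : μ ∈ A) :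
    InjOn (stepIndex g μ) A := by
  have key : ∀ a c : ℝ, ⌊a / g⌋ = ⌊c / g⌋ → |a - c| < g := by
    intro a c h
    have h1 := Int.abs_sub_lt_one_of_floor_eq_floor h
    rwa [← sub_div, abs_div, abs_of_pos hg, div_lt_one hg] at h1
  have pos : ∀ d : ℝ, g ≤ d → 1 ≤ ⌊d / g⌋ := by
    intro d hd
    rw [Int.le_floor, Int.cast_one]
    exact (one_le_div hg).2 hd
  have nonneg : ∀ d : ℝ, 0 ≤ d → 0 ≤ ⌊d / g⌋ := fun d hd => Int.floor_nonneg.2 (div_nonneg hd hg.le)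
  have sep : ∀ x ∈ A, x < μ → g ≤ μ - x := fun x hx h => by
    have : g ≤ |μ - x| := hA hμ hx h.ne'
    rwa [abs_of_pos (by linarith)] at this
  intro x hx y hy hxy
  by_contra hne
  have hd := hA hx hy hne
  unfold stepIndex at hxy
  split_ifs at hxy with h1 h2 h2
  · have := key _ _ hxy
    rw [show x - μ - (y - μ) = x - y by ring] at this
    linarith
  · have h3 := nonneg (x - μ) (by linarith)
    have h4 := pos _ (sep y hy (not_le.1 h2))
    omega
  · have h3 := nonneg (y - μ) (by linarith)
    have h4 := pos _ (sep x hx (not_le.1 h1))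
    omega
  · have := key _ _ (neg_inj.1 hxy)
    rw [show μ - x - (μ - y) = -(x - y) by ring, abs_neg] at this
    linarith

lemma stepIndex_ne_zero {A : Set ℝ} {g μ x : ℝ} (hg : 0 < g) (hA : IsSeparatedBy A g) (hμ : μ ∈ A)
    (hx : x ∈ A) (hne : x ≠ μ) : stepIndex g μ x ≠ 0 := by
  intro h
  apply hne
  refine stepIndex_injOn hg hA hμ hx hμ ?_
  rw [h]
  simp [stepIndex]

/-- Rounding towards zero means that the index never overestimates the distance. -/
lemma abs_stepIndex_mul_le {g : ℝ} (hg : 0 < g) (μ x : ℝ) :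
    |(stepIndex g μ x : ℝ)| * g ≤ |x - μ| := by
  unfold stepIndex
  split_ifs with h
  · rw [abs_of_nonneg (by exact_mod_cast Int.floor_nonneg.2 (div_nonneg (sub_nonneg.2 h) hg.le)),
      abs_of_nonneg (sub_nonneg.2 h)]
    exact (le_div_iff₀ hg).1 (Int.floor_le _)
  · have h' : 0 ≤ μ - x := by linarith
    push_cast
    rw [abs_neg, abs_of_nonneg (by exact_mod_cast Int.floor_nonneg.2 (div_nonneg h' hg.le)),
      abs_sub_comm, abs_of_nonneg h']
    exact (le_div_iff₀ hg).1 (Int.floor_le _)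

/-- The entries of the normalised Gram matrix away from the diagonal. -/
lemma norm_gram_le {A : Set ℝ} {g τ : ℝ} (hτ : 0 < τ) (hg : 2 * π < g * τ)
    (hA : IsSeparatedBy A g) {x μ : ℝ} (hx : x ∈ A) (hμ : μ ∈ A) (hne : x ≠ μ) :
    ‖expTransform (sineBump τ) (x - μ) / expTransform (sineBump τ) 0‖
      ≤ (2 * π / (g * τ)) ^ 2 * oddRecip (stepIndex g μ x) := by
  have hg0 : 0 < g := pos_of_mul_pos_left (Real.two_pi_pos.trans hg) hτ.le
  set n := stepIndex g μ x with hn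
  have hn0 : n ≠ 0 := stepIndex_ne_zero hg0 hA hμ hx hne
  have hn1 : (1 : ℝ) ≤ |(n : ℝ)| := by exact_mod_cast Int.one_le_abs hn0
  have hle := abs_stepIndex_mul_le hg0 μ x
  rw [← hn] at hle
  have ha : 0 < π / τ := div_pos Real.pi_pos hτ
  -- The excess ratio `α > 1` turns the step `g` into `2α` units of `π/τ`, so the entry is at most
  -- `1/(4α²n² - 1)`, and `α²(4n² - 1) ≤ 4α²n² - 1`.
  set α := g * τ / (2 * π) with hα
  have hα1 : 1 < α := (one_lt_div Real.two_pi_pos).2 hg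
  have hga : g = 2 * α * (π / τ) := by rw [hα]; field_simp
  have h1 : 2 * α * |(n : ℝ)| ≤ |x - μ| / (π / τ) := by
    rw [le_div_iff₀ ha]
    calc _ = |(n : ℝ)| * g := by rw [hga]; ring
      _ ≤ _ := hle
  have h2 : 1 < |x - μ| / (π / τ) := by nlinarith
  refine (norm_expTransform_sineBump_le hτ ((one_lt_div ha).1 h2)).trans ?_
  have h3 : (2 * α * |(n : ℝ)|) ^ 2 ≤ ((x - μ) / (π / τ)) ^ 2 := by
    rw [← sq_abs ((x - μ) / (π / τ)), abs_div, abs_of_pos ha]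
    exact pow_le_pow_left₀ (by positivity) h1 2
  have h4 : 1 ≤ (n : ℝ) ^ 2 := by rw [← sq_abs]; exact one_le_pow₀ hn1
  rw [mul_pow, sq_abs] at h3
  have h5 : 2 * π / (g * τ) = 1 / α := by rw [hα, one_div_div]
  rw [h5, oddRecip, if_neg hn0, one_div_pow, one_div_mul_one_div]
  have hα2 : 1 < α ^ 2 := one_lt_pow₀ hα1 two_ne_zero
  apply one_div_le_one_div_of_le
  · nlinarith
  · nlinarith

/-! ### Diagonally dominant systems in `ℓ¹` -/

/-- A bounded family in a Banach space extends to a bounded operator on `ℓ¹`. -/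
lemma exists_clm_of_bounded_family {ι E : Type*} [NormedAddCommGroup E] [NormedSpace ℂ E]
    [CompleteSpace E] (v : ι → E) {θ : ℝ} (hv : ∀ i, ‖v i‖ ≤ θ) :
    ∃ L : lp (fun _ : ι => ℂ) 1 →L[ℂ] E,
      (∀ x, HasSum (fun i => x i • v i) (L x)) ∧ ∀ x, ‖L x‖ ≤ θ * ‖x‖ := by
  have hx : ∀ x : lp (fun _ : ι => ℂ) 1, HasSum (fun i => ‖x i‖) ‖x‖ := by
    intro x
    have h := lp.hasSum_norm (p := 1) (by norm_num) x
    simpa using h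
  have hb : ∀ (x : lp (fun _ : ι => ℂ) 1) i, ‖x i • v i‖ ≤ θ * ‖x i‖ := by
    intro x i
    rw [norm_smul, mul_comm]
    exact mul_le_mul_of_nonneg_right (hv i) (norm_nonneg _)
  have hs : ∀ x : lp (fun _ : ι => ℂ) 1, Summable (fun i => x i • v i) := fun x =>
    Summable.of_norm_bounded ((hx x).summable.mul_left θ) (hb x)
  refine ⟨LinearMap.mkContinuous
    { toFun := fun x => ∑' i, x i • v i
      map_add' := fun x y => ?_
      map_smul' := fun c x => ?_ } θ fun x => ?_, fun x => (hs x).hasSum, fun x => ?_⟩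
  · rw [← (hs x).tsum_add (hs y)]
    exact tsum_congr fun i => by simp [add_smul]
  · rw [RingHom.id_apply, ← (hs x).tsum_const_smul]
    exact tsum_congr fun i => by simp [smul_smul]
  · exact tsum_of_norm_bounded ((hx x).mul_left θ) (hb x)
  · exact tsum_of_norm_bounded ((hx x).mul_left θ) (hb x)

/-- On `ℓ¹` the norm of a matrix is the supremum of its column sums, so the off-diagonal part has
norm at most `θ < 1` and a Neumann series inverts `K`. Absolutely summable coefficients are what
later makes the dual functions continuous and bounded. -/
lemma exists_l1_solution {ι : Type*} [DecidableEq ι] (K : ι → ι → ℂ) {θ : ℝ} (h0 : 0 ≤ θ)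
    (h1 : θ < 1) (hdiag : ∀ i, K i i = 1)
    (hsum : ∀ l, Summable fun k => if k = l then 0 else ‖K k l‖)
    (htsum : ∀ l, ∑' k, (if k = l then 0 else ‖K k l‖) ≤ θ) (μ : ι) :
    ∃ x : ι → ℂ, (Summable fun i => ‖x i‖) ∧ ∑' i, ‖x i‖ ≤ 1 / (1 - θ) ∧
      ∀ k, HasSum (fun l => x l * K k l) (if k = μ then 1 else 0) := by
  have hcol : ∀ l, Memℓp (fun k => if k = l then 0 else -K k l) 1 := by
    intro l
    rw [memℓp_gen_iff (by norm_num)]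
    refine (hsum l).congr fun k => ?_
    split_ifs <;> simp
  let v : ι → lp (fun _ : ι => ℂ) 1 := fun l => ⟨_, hcol l⟩
  have hvapp : ∀ l k, v l k = if k = l then 0 else -K k l := fun l k => rfl
  have hv : ∀ l, ‖v l‖ ≤ θ := by
    intro l
    have h := lp.hasSum_norm (p := 1) (by norm_num) (v l)
    simp only [ENNReal.toReal_one, Real.rpow_one] at h
    rw [← h.tsum_eq]
    refine le_trans (le_of_eq (tsum_congr fun k => ?_)) (htsum l)
    rw [hvapp]
    split_ifs <;> simp
  obtain ⟨L, hL, hLn⟩ := exists_clm_of_bounded_family v hv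
  have hLnorm : ‖L‖ < 1 := (L.opNorm_le_bound h0 hLn).trans_lt h1
  let e : lp (fun _ : ι => ℂ) 1 := lp.single 1 μ (1 : ℂ)
  obtain ⟨x, hx⟩ : ∃ x, x - L x = e := by
    let U := Units.oneSub L hLnorm
    refine ⟨(↑U⁻¹ : lp (fun _ : ι => ℂ) 1 →L[ℂ] lp (fun _ : ι => ℂ) 1) e, ?_⟩
    have h : (↑U * ↑U⁻¹ : lp (fun _ : ι => ℂ) 1 →L[ℂ] lp (fun _ : ι => ℂ) 1) e = e := by
      rw [Units.mul_inv]; rfl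
    exact h
  have hxs := lp.hasSum_norm (p := 1) (by norm_num) x
  simp only [ENNReal.toReal_one, Real.rpow_one] at hxs
  refine ⟨x, hxs.summable, ?_, fun k => ?_⟩
  · rw [hxs.tsum_eq, le_div_iff₀ (by linarith)]
    have he : ‖e‖ = 1 := by rw [lp.norm_single (by norm_num)]; simp
    have h2 : ‖x‖ ≤ ‖e‖ + θ * ‖x‖ := by
      calc ‖x‖ = ‖e + L x‖ := by rw [← hx]; simp
        _ ≤ ‖e‖ + ‖L x‖ := norm_add_le _ _
        _ ≤ _ := by gcongr; exact hLn x
    rw [he] at h2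
    linarith
  · have hev := (hL x).mapL (lp.evalCLM ℂ (fun _ : ι => ℂ) (1 : ℝ≥0∞) k)
    have hs1 := hasSum_single (f := fun l => if k = l then x l else 0) k
      (fun l hl => if_neg (Ne.symm hl))
    simp only [if_true] at hs1
    have h := hs1.sub hev
    have hxk : x k - L x k = e k := by rw [← hx]; rfl
    have hek : e k = if k = μ then (1 : ℂ) else 0 := by
      simp only [e, lp.coeFn_single, Pi.single_apply]
    rw [← hek, ← hxk]
    refine h.congr_fun ?_
    intro l
    change x l * K k l = (if k = l then x l else 0) - x l • v l k
    rw [hvapp]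
    split_ifs with hkl
    · subst hkl; simp [hdiag]
    · simp

/-! ### Biorthogonal functions for separated frequencies -/

lemma expTransform_mul_exp (q : ℝ → ℂ) (l ξ : ℝ) :
    expTransform (fun t => q t * Complex.exp (Complex.I * l * t)) ξ = expTransform q (ξ - l) := by
  unfold expTransform
  congr 1
  ext t
  rw [mul_assoc, ← Complex.exp_add]
  congr 2
  push_cast
  ring

lemma IsSeparatedBy.countable {A : Set ℝ} {g : ℝ} (hg : 0 < g) (hA : IsSeparatedBy A g) :
    A.Countable := by
  rcases A.eq_empty_or_nonempty with rfl | ⟨μ, hμ⟩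
  · exact countable_empty
  · have : Countable A := Function.Injective.countable
      (f := fun x : A => stepIndex g μ x) (injOn_iff_injective.1 (stepIndex_injOn hg hA hμ))
    exact this

lemma expTransform_sineBump_zero_ne {τ : ℝ} (hτ : 0 < τ) : expTransform (sineBump τ) 0 ≠ 0 := by
  rw [expTransform_sineBump_zero hτ]
  exact Complex.ofReal_ne_zero.2 (div_pos two_pos (div_pos Real.pi_pos hτ)).ne'

/-- Frequencies with gap `g` have a uniformly bounded biorthogonal family of functions supported in
`[0, τ]` as soon as `g τ > 2π`. -/
lemma exists_biorthogonal_of_separated {g τ : ℝ} (hτ : 0 < τ) (hg : 2 * π < g * τ) :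
    ∃ M : ℝ, ∀ A : Set ℝ, IsSeparatedBy A g → ∀ μ ∈ A, ∃ q : ℝ → ℂ, IsControlShape τ M q ∧
      ∀ x ∈ A, expTransform q x = if x = μ then 1 else 0 := by
  classical
  have hg0 : 0 < g := pos_of_mul_pos_left (Real.two_pi_pos.trans hg) hτ.le
  set θ : ℝ := (2 * π / (g * τ)) ^ 2
  have h0 : 0 ≤ θ := sq_nonneg _
  have h1 : θ < 1 := by
    have hpos : 0 < g * τ := mul_pos hg0 hτ
    exact pow_lt_one₀ (by positivity) ((div_lt_one hpos).2 hg) two_ne_zero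
  set κ : ℂ := expTransform (sineBump τ) 0 with hκ
  have hκ0 : κ ≠ 0 := expTransform_sineBump_zero_ne hτ
  -- The factors are the `ℓ¹` bound on the coefficients and the normalisation of the bump, which
  -- itself is bounded by `1`. Neither sees `A` or `μ`.
  refine ⟨1 / (1 - θ) * ‖κ⁻¹‖, fun A hA μ hμ => ?_⟩
  have hcount : Countable A := hA.countable hg0
  -- The Gram matrix of the exponentials with respect to the weight `sineBump τ`, normalised to have
  -- diagonal one.
  let K : A → A → ℂ := fun k l => expTransform (sineBump τ) ((k : ℝ) - l) / κ
  have hle : ∀ l k : A, (if k = l then 0 else ‖K k l‖) ≤ θ * oddRecip (stepIndex g l k) := by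
    intro l k
    split_ifs with h
    · exact mul_nonneg h0 (oddRecip_nonneg _)
    · exact norm_gram_le hτ hg hA k.2 l.2 fun h' => h (Subtype.ext h')
  have hinj : ∀ l : A, Function.Injective fun k : A => stepIndex g (l : ℝ) k := fun l =>
    injOn_iff_injective.1 (stepIndex_injOn hg0 hA l.2)
  have hsumr : ∀ l : A, Summable fun k : A => θ * oddRecip (stepIndex g l k) := fun l =>
    (hasSum_oddRecip.summable.comp_injective (hinj l)).mul_left θ
  have hsum : ∀ l, Summable fun k => if k = l then 0 else ‖K k l‖ := fun l =>
    Summable.of_nonneg_of_le (fun k => by split_ifs <;> positivity) (hle l) (hsumr l)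
  have htsum : ∀ l, ∑' k, (if k = l then 0 else ‖K k l‖) ≤ θ := by
    intro l
    refine ((hsum l).tsum_le_tsum (hle l) (hsumr l)).trans ?_
    rw [tsum_mul_left]
    have := tsum_comp_le_tsum_of_inj hasSum_oddRecip.summable oddRecip_nonneg (hinj l)
    rw [hasSum_oddRecip.tsum_eq] at this
    exact mul_le_of_le_one_right h0 this
  obtain ⟨x, hxs, hxle, hx⟩ := exists_l1_solution K h0 h1
    (fun i => by simp only [K, sub_self]; exact div_self hκ0) hsum htsum ⟨μ, hμ⟩
  have hb := isControlShape_sineBump hτ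
  -- The dual function is an `ℓ¹` combination of weighted exponentials; testing it against
  -- `e^{-iyt}` gives row `y` of the linear system.
  let F : A → ℝ → ℂ := fun l t => x l * κ⁻¹ * (sineBump τ t * Complex.exp (Complex.I * (l : ℝ) * t))
  have hexp : ∀ l t : ℝ, ‖Complex.exp (Complex.I * l * t)‖ = 1 := fun l t => by
    have := norm_exp_neg_I_mul (-l) t
    simpa using this
  have hF : ∀ l t, ‖F l t‖ ≤ ‖x l‖ * ‖κ⁻¹‖ := by
    intro l t
    simp only [F, norm_mul, hexp, mul_one]
    exact mul_le_of_le_one_right (by positivity) (hb.bound t)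
  have hFs : Summable fun l => ‖x l‖ * ‖κ⁻¹‖ := hxs.mul_right _
  refine ⟨fun t => ∑' l, F l t, ⟨?_, fun t ht => ?_, fun t => ?_⟩, fun y hy => ?_⟩
  · refine continuous_tsum (fun l => ?_) hFs hF
    have := hb.continuous
    fun_prop
  · simp [F, hb.support t ht]
  · refine (tsum_of_norm_bounded hFs.hasSum fun l => hF l t).trans ?_
    rw [tsum_mul_right]
    exact mul_le_mul_of_nonneg_right hxle (norm_nonneg _)
  · have hint : ∀ l, Integrable (fun t : ℝ => F l t * Complex.exp (-(Complex.I * y * t))) := by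
      intro l
      have hc := hb.continuous
      refine Continuous.integrable_of_hasCompactSupport (by fun_prop) ?_
      exact HasCompactSupport.intro (K := Icc 0 τ) isCompact_Icc fun t ht => by simp [F, hb.support t ht]
    have hnorm : ∀ l, ∫ t : ℝ, ‖F l t * Complex.exp (-(Complex.I * y * t))‖
        = ‖x l‖ * ‖κ⁻¹‖ * ∫ t : ℝ, ‖sineBump τ t‖ := by
      intro l
      rw [← integral_const_mul]
      congr 1
      ext t
      simp only [F, norm_mul, hexp, norm_exp_neg_I_mul, mul_one]
    have hS := hasSum_integral_of_summable_integral_norm hint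
      (by simp_rw [hnorm]; exact hFs.mul_right _)
    have hterm : ∀ l : A, ∫ t : ℝ, F l t * Complex.exp (-(Complex.I * y * t)) = x l * K ⟨y, hy⟩ l := by
      intro l
      have h2 := expTransform_const_mul (x l * κ⁻¹)
        (fun t => sineBump τ t * Complex.exp (Complex.I * (l : ℝ) * t)) y
      rw [expTransform_mul_exp] at h2
      refine Eq.trans h2 ?_
      simp only [K]
      ring
    simp_rw [hterm] at hS
    have h3 := hS.unique (hx ⟨y, hy⟩)
    simp only [tsum_mul_right] at h3
    unfold expTransform
    rw [h3]
    simp only [Subtype.mk.injEq]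

/-! ### Removing finitely many frequencies -/

/-- `1 - ε⁻¹ ∫₀^ε e^{-iξs} ds`. -/
def avgFactor (ε ξ : ℝ) : ℂ := 1 - (1 / ε : ℂ) * ∫ s in (0 : ℝ)..ε, Complex.exp (-(Complex.I * ξ * s))

lemma avgFactor_zero {ε : ℝ} (hε : 0 < ε) : avgFactor ε 0 = 0 := by
  have : (ε : ℂ) ≠ 0 := Complex.ofReal_ne_zero.2 hε.ne'
  simp [avgFactor, this]

lemma sinc_lt_one {x : ℝ} (hx : x ≠ 0) : Real.sinc x < 1 := by
  wlog h : 0 < x generalizing x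
  · rw [← Real.sinc_neg]
    exact this (neg_ne_zero.2 hx) (by
      rcases lt_or_gt_of_ne hx with h' | h'
      · linarith
      · exact absurd h' h)
  · rw [Real.sinc_of_ne_zero hx, div_lt_one h]
    exact Real.sin_lt h

/-- Compactness handles `δ ≤ |x| ≤ max δ 2`; beyond `2` the bound `1/|x| ≤ 1/2` takes over. -/
lemma exists_sinc_le {δ : ℝ} (hδ : 0 < δ) : ∃ c < 1, 0 ≤ c ∧ ∀ x, δ ≤ |x| → Real.sinc x ≤ c := by
  obtain ⟨x₀, hx₀, hmax⟩ := (isCompact_Icc (a := δ) (b := max δ 2)).exists_isMaxOn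
    ⟨δ, left_mem_Icc.2 (le_max_left _ _)⟩ Real.continuous_sinc.continuousOn
  refine ⟨max (Real.sinc x₀) (1 / 2), max_lt (sinc_lt_one (hδ.trans_le hx₀.1).ne') (by norm_num),
    le_max_of_le_right (by norm_num), fun x hx => ?_⟩
  rcases le_total |x| (max δ 2) with h | h
  · refine le_max_of_le_left ?_
    have h1 : Real.sinc x = Real.sinc |x| := by
      rcases abs_choice x with h' | h' <;> rw [h']
      rw [Real.sinc_neg]
    rw [h1]
    exact hmax ⟨hx, h⟩
  · refine le_max_of_le_right ?_
    have h2 : 2 ≤ |x| := (le_max_right _ _).trans h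
    refine (Real.sinc_le_inv_abs (abs_pos.1 (hδ.trans_le hx))).trans ?_
    rw [one_div]
    exact inv_anti₀ two_pos h2

/-- The real part alone keeps `avgFactor` away from zero, uniformly for all `ξ` outside a
neighbourhood of the origin. -/
lemma re_avgFactor {ε : ℝ} (hε : 0 < ε) (ξ : ℝ) : (avgFactor ε ξ).re = 1 - Real.sinc (ξ * ε) := by
  rcases eq_or_ne ξ 0 with rfl | hξ
  · simp [avgFactor_zero hε]
  have hc : Complex.I * (ξ : ℂ) ≠ 0 := mul_ne_zero Complex.I_ne_zero (Complex.ofReal_ne_zero.2 hξ)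
  have hε' : (ε : ℂ) ≠ 0 := Complex.ofReal_ne_zero.2 hε.ne'
  have h : ∫ s in (0 : ℝ)..ε, Complex.exp (-(Complex.I * ξ * s))
      = (Complex.exp (-(Complex.I * ξ) * ε) - Complex.exp (-(Complex.I * ξ) * (0 : ℝ)))
        / (-(Complex.I * ξ)) := by
    rw [← integral_exp_mul_complex (neg_ne_zero.2 hc)]
    simp only [neg_mul]
  rw [avgFactor, h]
  have he : Complex.exp (-(Complex.I * ξ) * ε) = Complex.cos ((ξ * ε : ℝ)) - Complex.sin ((ξ * ε : ℝ)) * Complex.I := by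
    have h2 := Complex.exp_mul_I (-((ξ * ε : ℝ) : ℂ))
    rw [Complex.cos_neg, Complex.sin_neg] at h2
    refine Eq.trans (congrArg Complex.exp ?_) (h2.trans (by ring))
    push_cast
    ring
  rw [he, Real.sinc_of_ne_zero (mul_ne_zero hξ hε.ne')]
  have hcalc : (1 / ε : ℂ) * ((Complex.cos ((ξ * ε : ℝ)) - Complex.sin ((ξ * ε : ℝ)) * Complex.I
      - Complex.exp (-(Complex.I * ξ) * (0 : ℝ))) / (-(Complex.I * ξ)))
      = ((Real.sin (ξ * ε) / (ξ * ε) : ℝ) : ℂ) + ((Real.cos (ξ * ε) - 1) / (ξ * ε) : ℝ) * Complex.I := by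
    simp only [Complex.ofReal_zero, mul_zero, Complex.exp_zero, ← Complex.ofReal_cos,
      ← Complex.ofReal_sin]
    push_cast
    have h1 : (ξ : ℂ) ≠ 0 := Complex.ofReal_ne_zero.2 hξ
    field_simp
    rw [mul_comm (ε : ℂ) (ξ : ℂ)]
    linear_combination (1 - Complex.cos (ξ * ε)) * Complex.I_sq
  rw [hcalc]
  simp [-Complex.ofReal_div, -Complex.ofReal_mul, -Complex.ofReal_sin, -Complex.ofReal_cos,
    -Complex.ofReal_sub]

lemma exists_le_norm_avgFactor {ε δ : ℝ} (hε : 0 < ε) (hδ : 0 < δ) :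
    ∃ c, 0 < c ∧ c ≤ 1 ∧ ∀ ξ, δ ≤ |ξ| → c ≤ ‖avgFactor ε ξ‖ := by
  obtain ⟨c, hc1, hc0, hc⟩ := exists_sinc_le (mul_pos hδ hε)
  refine ⟨1 - c, by linarith, by linarith, fun ξ hξ => ?_⟩
  have h1 : Real.sinc (ξ * ε) ≤ c := hc _ (by
    rw [abs_mul, abs_of_pos hε]; exact mul_le_mul_of_nonneg_right hξ hε.le)
  have h2 := Complex.abs_re_le_norm (avgFactor ε ξ)
  rw [re_avgFactor hε] at h2
  linarith [le_abs_self (1 - Real.sinc (ξ * ε))]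

/-- By Fubini, each translate by `s` contributes `e^{-iξs}`, which the modulation `e^{ifs}` shifts
to frequency `ξ - f`. -/
lemma integral_averaged {τ M ε : ℝ} (hτ : 0 ≤ τ) (hε : 0 < ε) {q : ℝ → ℂ}
    (hq : IsControlShape τ M q) (f ξ : ℝ) :
    ∫ t : ℝ, (∫ s in (0 : ℝ)..ε, Complex.exp (Complex.I * f * s) * q (t - s)) *
        Complex.exp (-(Complex.I * ξ * t))
      = (∫ s in (0 : ℝ)..ε, Complex.exp (-(Complex.I * (ξ - f : ℝ) * s))) * expTransform q ξ := by
  have hqc := hq.continuous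
  have hzero : ∀ t, t ∉ Icc 0 (τ + ε) → ∀ s ∈ Icc 0 ε, q (t - s) = 0 := by
    intro t ht s hs
    refine hq.support _ fun h => ht ⟨?_, ?_⟩ <;> linarith [h.1, h.2, hs.1, hs.2]
  let F : ℝ → ℝ → ℂ := fun t s =>
    Complex.exp (Complex.I * f * s) * q (t - s) * Complex.exp (-(Complex.I * ξ * t))
  have h1 : ∫ t : ℝ, (∫ s in (0 : ℝ)..ε, Complex.exp (Complex.I * f * s) * q (t - s)) *
        Complex.exp (-(Complex.I * ξ * t)) = ∫ t in Ioc 0 (τ + ε), ∫ s in Ioc 0 ε, F t s := by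
    rw [integral_eq_intervalIntegral_of_support (τ := τ + ε) (by positivity),
      intervalIntegral.integral_of_le (by positivity)]
    · refine setIntegral_congr_fun measurableSet_Ioc fun t _ => ?_
      simp only [F]
      rw [intervalIntegral.integral_of_le hε.le, ← integral_mul_const]
    · intro t ht
      rw [intervalIntegral.integral_congr (g := fun _ => 0), intervalIntegral.integral_zero, zero_mul]
      intro s hs
      rw [uIcc_of_le hε.le] at hs
      simp [hzero t ht s hs]
  have hint : Integrable (Function.uncurry F)
      ((volume.restrict (Ioc 0 (τ + ε))).prod (volume.restrict (Ioc 0 ε))) := by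
    rw [Measure.prod_restrict, ← Measure.volume_eq_prod]
    have hc : Continuous (Function.uncurry F) := by
      simp only [Function.uncurry_def, F]
      fun_prop
    exact (hc.continuousOn.integrableOn_compact
      ((isCompact_Icc (a := 0) (b := τ + ε)).prod (isCompact_Icc (a := 0) (b := ε)))).mono_set
      (prod_mono Ioc_subset_Icc_self Ioc_subset_Icc_self)
  rw [h1, integral_integral_swap hint, intervalIntegral.integral_of_le hε.le, ← integral_mul_const]
  refine setIntegral_congr_fun measurableSet_Ioc fun s hs => ?_
  have hs' : s ∈ Icc 0 ε := Ioc_subset_Icc_self hs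
  have h2 : ∫ t in Ioc 0 (τ + ε), F t s = ∫ t, F t s := by
    rw [← intervalIntegral.integral_of_le (by positivity),
      ← integral_eq_intervalIntegral_of_support (by positivity)]
    intro t ht
    simp [F, hzero t ht s hs']
  simp only [h2]
  have h3 := integral_sub_right_eq_self (μ := (volume : Measure ℝ)) (fun t : ℝ => F (t + s) s) s
  simp only [sub_add_cancel] at h3
  rw [h3, expTransform, ← integral_const_mul]
  congr 1
  ext t
  simp only [F, add_sub_cancel_right]
  have h4 : Complex.exp (Complex.I * f * s) * Complex.exp (-(Complex.I * ξ * ((t + s : ℝ) : ℂ)))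
      = Complex.exp (-(Complex.I * (ξ - f : ℝ) * s)) * Complex.exp (-(Complex.I * ξ * t)) := by
    rw [← Complex.exp_add, ← Complex.exp_add]
    congr 1
    push_cast
    ring
  linear_combination q t * h4

lemma continuous_averaged {q : ℝ → ℂ} (hq : Continuous q) (ε f : ℝ) :
    Continuous fun t : ℝ => ∫ s in (0 : ℝ)..ε, Complex.exp (Complex.I * f * s) * q (t - s) := by
  refine intervalIntegral.continuous_parametric_intervalIntegral_of_continuous' ?_ 0 ε
  simp only [Function.uncurry_def]
  fun_prop

/-- The transform can be made to vanish at a given frequency at the cost of a slightly larger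
support. -/
lemma IsControlShape.exists_remove {τ M ε : ℝ} (hτ : 0 ≤ τ) (hε : 0 < ε) {q : ℝ → ℂ}
    (hq : IsControlShape τ M q) (f : ℝ) :
    ∃ p : ℝ → ℂ, IsControlShape (τ + ε) (2 * M) p ∧
      ∀ ξ, expTransform p ξ = avgFactor ε (ξ - f) * expTransform q ξ := by
  have hqc := hq.continuous
  let r : ℝ → ℂ := fun t => ∫ s in (0 : ℝ)..ε, Complex.exp (Complex.I * f * s) * q (t - s)
  have hr : Continuous r := continuous_averaged hqc ε f
  have hrz : ∀ t, t ∉ Icc 0 (τ + ε) → r t = 0 := by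
    intro t ht
    simp only [r]
    rw [intervalIntegral.integral_congr (g := fun _ => 0), intervalIntegral.integral_zero]
    intro s hs
    rw [uIcc_of_le hε.le] at hs
    have : q (t - s) = 0 := by
      refine hq.support _ fun h => ht ⟨?_, ?_⟩ <;> linarith [h.1, h.2, hs.1, hs.2]
    simp [this]
  have hrb : ∀ t, ‖r t‖ ≤ M * ε := by
    intro t
    have h := intervalIntegral.norm_integral_le_of_norm_le_const (a := 0) (b := ε) (C := M)
      (f := fun s => Complex.exp (Complex.I * f * s) * q (t - s)) (fun s _ => by
        have := norm_exp_neg_I_mul (-f) s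
        rw [norm_mul, show Complex.I * f * s = -(Complex.I * (-f : ℝ) * s) by push_cast; ring,
          this, one_mul]
        exact hq.bound _)
    rwa [sub_zero, abs_of_pos hε] at h
  -- At frequency `f` the modulated average reproduces the transform of `q`, so the difference
  -- vanishes there. Translating by at most `ε` enlarges the support by `ε`, and the average obeys
  -- the same bound `M`.
  refine ⟨fun t => q t - (1 / ε : ℂ) * r t, ⟨by fun_prop, fun t ht => ?_, fun t => ?_⟩, fun ξ => ?_⟩
  · rw [hrz t ht, hq.support t fun h => ht ⟨h.1, h.2.trans (by linarith)⟩]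
    simp
  · refine (norm_sub_le _ _).trans ?_
    rw [norm_mul, norm_div, norm_one, Complex.norm_real, Real.norm_of_nonneg hε.le]
    have h1 : 1 / ε * ‖r t‖ ≤ M := by
      rw [one_div, inv_mul_le_iff₀ hε, mul_comm]
      exact hrb t
    linarith [hq.bound t]
  · have hI := integral_averaged hτ hε hq f ξ
    have hi1 : Integrable fun t : ℝ => q t * Complex.exp (-(Complex.I * ξ * t)) := by
      refine Continuous.integrable_of_hasCompactSupport (by fun_prop) ?_
      exact HasCompactSupport.intro (K := Icc 0 τ) isCompact_Icc fun t ht => by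
        simp [hq.support t ht]
    have hi2 : Integrable fun t : ℝ => (1 / ε : ℂ) * (r t * Complex.exp (-(Complex.I * ξ * t))) := by
      refine Continuous.integrable_of_hasCompactSupport (by fun_prop) ?_
      exact HasCompactSupport.intro (K := Icc 0 (τ + ε)) isCompact_Icc fun t ht => by
        simp [hrz t ht]
    have h2 : expTransform (fun t => q t - (1 / ε : ℂ) * r t) ξ
        = expTransform q ξ - (1 / ε : ℂ) * ∫ t : ℝ, r t * Complex.exp (-(Complex.I * ξ * t)) := by
      rw [expTransform, expTransform, ← integral_const_mul, ← integral_sub hi1 hi2]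
      congr 1
      ext t
      ring
    rw [h2, hI, avgFactor]
    ring

lemma IsControlShape.exists_remove_finset {τ M ε : ℝ} (hτ : 0 ≤ τ) (hε : 0 < ε) {q : ℝ → ℂ}
    (hq : IsControlShape τ M q) (B : Finset ℝ) :
    ∃ p : ℝ → ℂ, IsControlShape (τ + B.card * ε) (2 ^ B.card * M) p ∧
      ∀ ξ, expTransform p ξ = (∏ f ∈ B, avgFactor ε (ξ - f)) * expTransform q ξ := by
  classical
  induction B using Finset.induction_on with
  | empty => exact ⟨q, by simpa using hq, by simp⟩
  | insert f B hf ih =>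
    obtain ⟨p, hp, hpt⟩ := ih
    obtain ⟨p', hp', hpt'⟩ := hp.exists_remove (by positivity) hε f
    refine ⟨p', ?_, fun ξ => ?_⟩
    · rw [Finset.card_insert_of_notMem hf]
      refine hp'.mono (le_of_eq ?_) (le_of_eq ?_)
      · push_cast; ring
      · rw [pow_succ]; ring
    · rw [hpt', hpt, Finset.prod_insert hf, mul_assoc]

/-! ### Biorthogonal functions -/

/-- Each of the half-open intervals `[μ - g, μ)` and `[μ, μ + g)` holds at most one point; they
correspond to the floors `-1` and `0`. -/
lemma IsSeparatedBy.exists_near_finset {A : Set ℝ} {g : ℝ} (hg : 0 < g) (hA : IsSeparatedBy A g)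
    (μ : ℝ) : ∃ B : Finset ℝ, B.card ≤ 2 ∧ ∀ x, x ∈ B ↔ x ∈ A ∧ |x - μ| < g := by
  have hmaps : MapsTo (fun x => ⌊(x - μ) / g⌋) {x | x ∈ A ∧ |x - μ| < g}
      (({-1, 0} : Finset ℤ) : Set ℤ) := by
    intro x hx
    have h := abs_lt.1 hx.2
    have h1 : -1 ≤ ⌊(x - μ) / g⌋ := by
      rw [Int.le_floor, le_div_iff₀ hg]; push_cast; linarith
    have h2 : ⌊(x - μ) / g⌋ < 1 := by
      rw [Int.floor_lt, div_lt_iff₀ hg]; push_cast; linarith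
    simp only [Finset.coe_insert, Finset.coe_singleton, mem_insert_iff, mem_singleton_iff]
    omega
  have hinj : InjOn (fun x => ⌊(x - μ) / g⌋) {x | x ∈ A ∧ |x - μ| < g} := by
    intro x hx y hy hxy
    by_contra hne
    have h1 := Int.abs_sub_lt_one_of_floor_eq_floor hxy
    rw [← sub_div, abs_div, abs_of_pos hg, div_lt_one hg, sub_sub_sub_cancel_right] at h1
    have h2 : g ≤ |x - y| := hA hx.1 hy.1 hne
    linarith
  have hfin : {x | x ∈ A ∧ |x - μ| < g}.Finite :=
    Finite.of_injOn hmaps hinj (Finset.finite_toSet _)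
  refine ⟨hfin.toFinset, ?_, fun x => by simp⟩
  refine Finset.card_le_card_of_injOn (t := ({-1, 0} : Finset ℤ)) (fun x => ⌊(x - μ) / g⌋) ?_ ?_
  · rwa [Finite.coe_toFinset]
  · rwa [Finite.coe_toFinset]

/-- If `Λ` is separated and all but finitely many of its elements have gap `g > 2π / T`, then the
exponentials with frequencies in `Λ` have a uniformly bounded biorthogonal family supported in
`[0, T]`. -/
theorem exists_uniform_biorthogonal {Λ : Set ℝ} {γ g T : ℝ} (hγ : 0 < γ) (hΛ : IsSeparatedBy Λ γ)
    (F : Finset ℝ) (hg : 0 < g) (hF : IsSeparatedBy (Λ \ F) g) (hT : 2 * π < g * T) :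
    ∃ M : ℝ, ∀ μ ∈ Λ, ∃ q : ℝ → ℂ, IsControlShape T M q ∧
      ∀ x ∈ Λ, expTransform q x = if x = μ then 1 else 0 := by
  classical
  have hT' : 2 * π / g < T := by rw [div_lt_iff₀ hg]; linarith
  obtain ⟨τ, hτ1, hτ2⟩ := exists_between hT'
  have hτ : 0 < τ := (div_pos Real.two_pi_pos hg).trans hτ1
  have hgτ : 2 * π < g * τ := by rw [div_lt_iff₀ hg] at hτ1; linarith
  obtain ⟨M, hM⟩ := exists_biorthogonal_of_separated hτ hgτ
  -- At most `F` and two further points near `μ` must be removed; `N` windows of length `ε` exactly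
  -- fill the spare time `T - τ`.
  set N : ℕ := F.card + 2
  set ε : ℝ := (T - τ) / N with hεdef
  have hN : (0 : ℝ) < N := by positivity
  have hε : 0 < ε := div_pos (by linarith) hN
  obtain ⟨c, hc0, hc1, hc⟩ := exists_le_norm_avgFactor hε hγ
  refine ⟨(c ^ N)⁻¹ * (2 ^ N * M), fun μ hμ => ?_⟩
  obtain ⟨B₀, hB₀, hmem⟩ := hF.exists_near_finset hg μ
  set B : Finset ℝ := ((F ∪ B₀).filter (· ∈ Λ)).erase μ with hB
  have hBN : B.card ≤ N := by
    refine (Finset.card_erase_le).trans ((Finset.card_filter_le _ _).trans ?_)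
    exact (Finset.card_union_le _ _).trans (by omega)
  -- Since `μ` may itself belong to `F`, its neighbours within `g` are also left out; the rest
  -- together with `μ` has gap `g`.
  set A : Set ℝ := insert μ {x | x ∈ Λ ∧ x ∉ F ∧ g ≤ |x - μ|} with hA
  have hAsep : IsSeparatedBy A g := by
    intro x hx y hy hne
    rcases hx with rfl | hx <;> rcases hy with rfl | hy
    · exact absurd rfl hne
    · rw [abs_sub_comm]; exact hy.2.2
    · exact hx.2.2
    · exact hF ⟨hx.1, hx.2.1⟩ ⟨hy.1, hy.2.1⟩ hne
  obtain ⟨q, hq, hqt⟩ := hM A hAsep μ (mem_insert _ _)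
  have hM0 : 0 ≤ M := (norm_nonneg _).trans (hq.bound 0)
  obtain ⟨p, hp, hpt⟩ := hq.exists_remove_finset hτ.le hε B
  -- The removals multiply the value at `μ` by `P`, which the gap `γ` bounds below by `c ^ N`
  -- uniformly in `μ`.
  set P : ℂ := ∏ f ∈ B, avgFactor ε (μ - f) with hP
  have hPc : c ^ N ≤ ‖P‖ := by
    rw [hP, norm_prod]
    calc c ^ N ≤ c ^ B.card := pow_le_pow_of_le_one hc0.le hc1 hBN
      _ = ∏ f ∈ B, c := by rw [Finset.prod_const]
      _ ≤ _ := Finset.prod_le_prod (fun _ _ => hc0.le) fun f hf => hc _ (by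
        rw [hB, Finset.mem_erase, Finset.mem_filter] at hf
        exact hΛ hμ hf.2.2 (Ne.symm hf.1))
  have hcN : 0 < c ^ N := pow_pos hc0 N
  have hP0 : P ≠ 0 := norm_pos_iff.1 (hcN.trans_le hPc)
  refine ⟨fun t => P⁻¹ * p t, (hp.const_mul P⁻¹).mono ?_ ?_, fun x hx => ?_⟩
  · have h1 : (B.card : ℝ) * ε ≤ N * ε := by gcongr
    have h2 : N * ε = T - τ := by rw [hεdef]; field_simp
    linarith
  · rw [norm_inv]
    gcongr
    norm_num
  · rw [expTransform_const_mul, hpt]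
    by_cases hxμ : x = μ
    · subst hxμ
      rw [hqt x (mem_insert _ _), if_pos rfl, mul_one, ← hP, inv_mul_cancel₀ hP0]
    rw [if_neg hxμ]
    by_cases hxB : x ∈ B
    · rw [Finset.prod_eq_zero hxB (by rw [sub_self, avgFactor_zero hε])]
      simp
    · have hxA : x ∈ A := by
        refine Or.inr ⟨hx, fun hxF => hxB ?_, ?_⟩
        · simp [hB, hxμ, hxF, hx]
        · by_contra hlt
          apply hxB
          by_cases hxF : x ∈ F
          · simp [hB, hxμ, hxF, hx]
          · have : x ∈ B₀ := (hmem x).2 ⟨⟨hx, hxF⟩, not_le.1 hlt⟩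
            simp [hB, hxμ, this, hx]
      rw [hqt x hxA, if_neg hxμ]
      simp

namespace Sobolev

variable {s s' : ℝ}

/-! ### Completeness and coefficient functionals -/

@[ext] lemma ext {u v : Sobolev s} (h : ∀ k, u.coeff k = v.coeff k) : u = v :=
  Subtype.ext (funext h)

@[simp] lemma coeff_add (u v : Sobolev s) (k : ℤ × ℤ) :
    (u + v).coeff k = u.coeff k + v.coeff k := (rfl)

@[simp] lemma coeff_sub (u v : Sobolev s) (k : ℤ × ℤ) :
    (u - v).coeff k = u.coeff k - v.coeff k := (rfl)

@[simp] lemma coeff_smul (c : ℂ) (u : Sobolev s) (k : ℤ × ℤ) :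
    (c • u).coeff k = c * u.coeff k := (rfl)

lemma val_incl (h : s' ≤ s) (u : Sobolev s) : (u.incl h).1 = u.coeff := rfl

lemma coeff_incl (h : s' ≤ s) (u : Sobolev s) (k : ℤ × ℤ) :
    (u.incl h).coeff k = u.coeff k := by
  rw [coeff, val_incl]

lemma norm_eq (u : Sobolev s) : ‖u‖ = ‖toEll s u‖ := rfl

lemma toEll_apply (u : Sobolev s) (k : ℤ × ℤ) :
    toEll s u k = (weight s k : ℂ) * u.coeff k := (rfl)

lemma norm_toEll_apply (u : Sobolev s) (k : ℤ × ℤ) : ‖toEll s u k‖ = weight s k * ‖u.coeff k‖ := by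
  rw [toEll_apply, norm_mul, Complex.norm_real, Real.norm_of_nonneg (weight_pos s k).le]

lemma toEll_surjective (s : ℝ) : Function.Surjective (toEll s) := by
  intro x
  have h : ∀ k, (weight s k : ℂ) * ((weight s k : ℂ)⁻¹ * x k) = x k := fun k =>
    mul_inv_cancel_left₀ (Complex.ofReal_ne_zero.2 (weight_pos s k).ne') _
  refine ⟨⟨fun k => (weight s k : ℂ)⁻¹ * x k, (summable_iff_memlp s _).2 ?_⟩, ?_⟩
  · simp_rw [h]
    exact lp.memℓp x
  · ext k
    exact h k

instance : CompleteSpace (Sobolev s) := by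
  have hiso : Isometry (toEll s) := AddMonoidHomClass.isometry_of_norm (toEll s) fun _ => rfl
  exact (hiso.isUniformInducing.completeSpace_congr (toEll_surjective s)).2 inferInstance

/-- The `k`-th Fourier coefficient as a continuous functional. -/
def coeffCLM (s : ℝ) (k : ℤ × ℤ) : Sobolev s →L[ℂ] ℂ :=
  LinearMap.mkContinuous
    { toFun := fun u => u.coeff k
      map_add' := fun _ _ => rfl
      map_smul' := fun _ _ => rfl } (weight s k)⁻¹ fun u => by
    change ‖u.coeff k‖ ≤ (weight s k)⁻¹ * ‖u‖
    rw [inv_mul_eq_div, le_div_iff₀ (weight_pos s k), mul_comm, ← norm_toEll_apply, norm_eq]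
    exact lp.norm_apply_le_norm (by norm_num) _ _

@[simp] lemma coeffCLM_apply (k : ℤ × ℤ) (u : Sobolev s) : coeffCLM s k u = u.coeff k := (rfl)

lemma continuous_coeff (k : ℤ × ℤ) : Continuous fun u : Sobolev s => u.coeff k :=
  (coeffCLM s k).continuous

lemma summable_sq (u : Sobolev s) : Summable fun k => (1 + len k) ^ (2 * s) * ‖u.coeff k‖ ^ 2 := u.2

/-! ### Weighted substitution operators -/

lemma sq_weighted_le {M a c d : ℝ} {k j : ℤ × ℤ} (ha : 0 ≤ a)
    (h : a * (1 + len k) ^ s' ≤ M * (1 + len j) ^ s) (hc : c = a * d) :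
    (1 + len k) ^ (2 * s') * c ^ 2 ≤ M ^ 2 * ((1 + len j) ^ (2 * s) * d ^ 2) := by
  have h0 : 0 ≤ a * (1 + len k) ^ s' := mul_nonneg ha (Real.rpow_nonneg (one_add_len_pos k).le _)
  have h2 := pow_le_pow_left₀ h0 h 2
  rw [hc, mul_comm 2 s, mul_comm 2 s', Real.rpow_mul (one_add_len_pos k).le,
    Real.rpow_mul (one_add_len_pos j).le, Real.rpow_two, Real.rpow_two]
  calc _ = (a * (1 + len k) ^ s') ^ 2 * d ^ 2 := by ring
    _ ≤ (M * (1 + len j) ^ s) ^ 2 * d ^ 2 := by gcongr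
    _ = _ := by ring

section WeightedSubst

variable {σ : ℤ × ℤ → ℤ × ℤ} {m : ℤ × ℤ → ℂ} {M : ℝ}

lemma weighted_term_le (hm : ∀ k, ‖m k‖ * (1 + len k) ^ s' ≤ M * (1 + len (σ k)) ^ s)
    (u : Sobolev s) (k : ℤ × ℤ) : (1 + len k) ^ (2 * s') * ‖m k * u.coeff (σ k)‖ ^ 2
      ≤ M ^ 2 * ((1 + len (σ k)) ^ (2 * s) * ‖u.coeff (σ k)‖ ^ 2) :=
  sq_weighted_le (norm_nonneg _) (hm k) (norm_mul _ _)

lemma summable_weighted_comp (hσ : Function.Injective σ) (u : Sobolev s) : Summable fun k =>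
    M ^ 2 * ((1 + len (σ k)) ^ (2 * s) * ‖u.coeff (σ k)‖ ^ 2) :=
  (u.summable_sq.comp_injective hσ).mul_left _

lemma mem_weightedSubst (hσ : Function.Injective σ)
    (hm : ∀ k, ‖m k‖ * (1 + len k) ^ s' ≤ M * (1 + len (σ k)) ^ s) (u : Sobolev s) :
    Summable fun k => (1 + len k) ^ (2 * s') * ‖m k * u.coeff (σ k)‖ ^ 2 :=
  Summable.of_nonneg_of_le
    (fun k => mul_nonneg (Real.rpow_nonneg (one_add_len_pos k).le _) (sq_nonneg _))
    (weighted_term_le hm u) (summable_weighted_comp hσ u)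

lemma norm_le_of_coeff_eq (hσ : Function.Injective σ) (hM : 0 ≤ M)
    (hm : ∀ k, ‖m k‖ * (1 + len k) ^ s' ≤ M * (1 + len (σ k)) ^ s) {u : Sobolev s}
    {v : Sobolev s'} (hv : ∀ k, v.coeff k = m k * u.coeff (σ k)) : ‖v‖ ≤ M * ‖u‖ := by
  refine abs_le_of_sq_le_sq' ?_ (by positivity) |>.2
  rw [mul_pow, norm_sq_eq, norm_sq_eq, mul_left_comm]
  refine mul_le_mul_of_nonneg_left ?_ (by positivity)
  simp_rw [hv]
  refine ((mem_weightedSubst hσ hm u).tsum_le_tsum (weighted_term_le hm u)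
    (summable_weighted_comp hσ u)).trans ?_
  rw [tsum_mul_left]
  refine mul_le_mul_of_nonneg_left ?_ (sq_nonneg _)
  exact tsum_comp_le_tsum_of_inj u.summable_sq
    (fun k => mul_nonneg (Real.rpow_nonneg (one_add_len_pos k).le _) (sq_nonneg _)) hσ

/-- The operator `u ↦ (m(k) û(σ(k)))_k` from `H^s` to `H^{s'}`. -/
def weightedSubst (σ : ℤ × ℤ → ℤ × ℤ) (hσ : Function.Injective σ) (m : ℤ × ℤ → ℂ) (M : ℝ)
    (hM : 0 ≤ M) (hm : ∀ k, ‖m k‖ * (1 + len k) ^ s' ≤ M * (1 + len (σ k)) ^ s) :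
    Sobolev s →L[ℂ] Sobolev s' :=
  LinearMap.mkContinuous
    { toFun := fun u => (⟨fun k => m k * u.coeff (σ k), mem_weightedSubst hσ hm u⟩ : Sobolev s')
      map_add' := fun _ _ => ext fun _ => mul_add _ _ _
      map_smul' := fun _ _ => ext fun _ => mul_left_comm _ _ _ } M fun _ =>
    norm_le_of_coeff_eq hσ hM hm fun _ => rfl

variable {hσ : Function.Injective σ} {hM : 0 ≤ M}
  {hm : ∀ k, ‖m k‖ * (1 + len k) ^ s' ≤ M * (1 + len (σ k)) ^ s}

@[simp] lemma coeff_weightedSubst (u : Sobolev s) (k : ℤ × ℤ) :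
    (weightedSubst σ hσ m M hM hm u).coeff k = m k * u.coeff (σ k) := (rfl)

lemma norm_weightedSubst_apply_le (u : Sobolev s) : ‖weightedSubst σ hσ m M hM hm u‖ ≤ M * ‖u‖ :=
  norm_le_of_coeff_eq hσ hM hm fun _ => rfl

lemma norm_weightedSubst_le : ‖weightedSubst σ hσ m M hM hm‖ ≤ M :=
  ContinuousLinearMap.opNorm_le_bound _ hM norm_weightedSubst_apply_le

end WeightedSubst

/-- The multiplier `u ↦ (m(k) û(k))_k` with bounded symbol on `H^s`. -/
def diag (m : ℤ × ℤ → ℂ) (M : ℝ) (hM : 0 ≤ M) (hm : ∀ k, ‖m k‖ ≤ M) : Sobolev s →L[ℂ] Sobolev s :=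
  weightedSubst id Function.injective_id m M hM fun k =>
    mul_le_mul_of_nonneg_right (hm k) (Real.rpow_nonneg (one_add_len_pos k).le _)

@[simp] lemma coeff_diag {m : ℤ × ℤ → ℂ} {M : ℝ} {hM : 0 ≤ M} {hm : ∀ k, ‖m k‖ ≤ M} (u : Sobolev s)
    (k : ℤ × ℤ) : (diag m M hM hm u).coeff k = m k * u.coeff k := (rfl)

lemma norm_diag_apply_le {m : ℤ × ℤ → ℂ} {M : ℝ} {hM : 0 ≤ M} {hm : ∀ k, ‖m k‖ ≤ M}
    (u : Sobolev s) : ‖diag m M hM hm u‖ ≤ M * ‖u‖ := norm_weightedSubst_apply_le u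

/-- The inclusion as a continuous linear map. -/
def inclCLM (h : s' ≤ s) : Sobolev s →L[ℂ] Sobolev s' :=
  weightedSubst id Function.injective_id (fun _ => 1) 1 zero_le_one fun k => by
    rw [norm_one, one_mul, one_mul]
    exact Real.rpow_le_rpow_of_exponent_le (le_add_of_nonneg_right (Real.sqrt_nonneg _)) h

lemma inclCLM_apply (h : s' ≤ s) (u : Sobolev s) : inclCLM h u = u.incl h :=
  ext fun k => by simp [inclCLM, coeff_incl]

/-- A bounded family of multipliers with continuous symbols acts continuously. -/
lemma continuous_diag_apply {m : ℝ → ℤ × ℤ → ℂ} {M : ℝ} (hM : 0 ≤ M) (hm : ∀ t k, ‖m t k‖ ≤ M)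
    (hc : ∀ k, Continuous fun t => m t k) {z : ℝ → Sobolev s} (hz : Continuous z) :
    Continuous fun t => diag (m t) M hM (hm t) (z t) := by
  -- The symbols are continuous only for each `k` separately, so the operators need not be norm
  -- continuous in `t`; strong continuity at a fixed vector follows by dominated convergence.
  have hfix : ∀ t₀, Filter.Tendsto (fun t => diag (m t) M hM (hm t) (z t₀) - diag (m t₀) M hM (hm t₀) (z t₀))
      (nhds t₀) (nhds 0) := by
    intro t₀
    set v := z t₀
    rw [tendsto_zero_iff_norm_tendsto_zero]
    have hsq : Filter.Tendsto (fun t => ‖diag (m t) M hM (hm t) v - diag (m t₀) M hM (hm t₀) v‖ ^ 2)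
        (nhds t₀) (nhds 0) := by
      simp_rw [norm_sq_eq, coeff_sub, coeff_diag]
      have ht : Filter.Tendsto (fun t => ∑' k, (1 + len k) ^ (2 * s) *
          ‖m t k * v.coeff k - m t₀ k * v.coeff k‖ ^ 2) (nhds t₀)
          (nhds (∑' k : ℤ × ℤ, (0 : ℝ))) := by
        refine tendsto_tsum_of_dominated_convergence
          (bound := fun k => (2 * M) ^ 2 * ((1 + len k) ^ (2 * s) * ‖v.coeff k‖ ^ 2))
          (v.summable_sq.mul_left _) (fun k => ?_) (Filter.Eventually.of_forall fun t k => ?_)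
        · have h1 : Continuous fun t => (1 + len k) ^ (2 * s) *
              ‖m t k * v.coeff k - m t₀ k * v.coeff k‖ ^ 2 := by
            have := hc k
            fun_prop
          have h2 := h1.tendsto t₀
          simpa using h2
        · have hp : 0 ≤ (1 + len k) ^ (2 * s) := Real.rpow_nonneg (one_add_len_pos k).le _
          rw [Real.norm_of_nonneg (mul_nonneg hp (sq_nonneg _)), ← sub_mul, norm_mul, mul_pow,
            mul_left_comm]
          have h3 : ‖m t k - m t₀ k‖ ≤ 2 * M :=
            (norm_sub_le _ _).trans (by linarith [hm t k, hm t₀ k])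
          gcongr
      rw [tsum_zero] at ht
      simpa using ht.const_mul ((2 * π) ^ 2)
    have := hsq.sqrt
    simpa [Real.sqrt_sq (norm_nonneg _)] using this
  rw [continuous_iff_continuousAt]
  intro t₀
  have h1 : Filter.Tendsto (fun t => diag (m t) M hM (hm t) (z t - z t₀)) (nhds t₀) (nhds 0) := by
    refine squeeze_zero_norm (fun t => norm_diag_apply_le _) ?_
    have h2 : Continuous fun t => M * ‖z t - z t₀‖ := by fun_prop
    simpa using h2.tendsto t₀
  have h3 := (h1.add (hfix t₀)).add_const (diag (m t₀) M hM (hm t₀) (z t₀))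
  rw [zero_add, zero_add] at h3
  refine h3.congr fun t => ?_
  rw [map_sub]
  abel

lemma exists_continuous_diag {m : ℝ → ℤ × ℤ → ℂ} {M : ℝ} (hM : 0 ≤ M) (hm : ∀ t k, ‖m t k‖ ≤ M)
    (hc : ∀ k, Continuous fun t => m t k) {z : ℝ → Sobolev s} (hz : Continuous z) :
    ∃ u : ℝ → Sobolev s, Continuous u ∧ ∀ t k, (u t).coeff k = m t k * (z t).coeff k :=
  ⟨fun t => diag (m t) M hM (hm t) (z t), continuous_diag_apply hM hm hc hz,
    fun t k => coeff_diag (z t) k⟩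

end Sobolev

/-! ### The inhomogeneous equation -/

open Sobolev

lemma norm_exp_I_mul (ξ t : ℝ) : ‖Complex.exp (Complex.I * ξ * t)‖ = 1 := by
  have := norm_exp_neg_I_mul (-ξ) t
  simpa using this

lemma hasDerivAt_duhamel (ξ : ℝ) (c : ℂ) {φ : ℝ → ℂ} (hφ : Continuous φ) (t : ℝ) :
    HasDerivAt (fun t : ℝ => Complex.exp (Complex.I * ξ * t) *
        (c + ∫ τ in (0 : ℝ)..t, Complex.exp (-(Complex.I * ξ * τ)) * φ τ))
      (Complex.I * ξ * (Complex.exp (Complex.I * ξ * t) *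
        (c + ∫ τ in (0 : ℝ)..t, Complex.exp (-(Complex.I * ξ * τ)) * φ τ)) + φ t) t := by
  have hc : Continuous fun τ : ℝ => Complex.exp (-(Complex.I * ξ * τ)) * φ τ := by fun_prop
  have h1 := intervalIntegral.integral_hasDerivAt_right (hc.intervalIntegrable 0 t)
    (hc.stronglyMeasurableAtFilter _ _) hc.continuousAt
  have h0 : HasDerivAt (fun t : ℝ => (t : ℂ)) 1 t := Complex.ofRealCLM.hasDerivAt
  have h2 : HasDerivAt (fun t : ℝ => Complex.exp (Complex.I * ξ * t))
      (Complex.exp (Complex.I * ξ * t) * (Complex.I * ξ * 1)) t :=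
    (h0.const_mul (Complex.I * (ξ : ℂ))).cexp
  have hee : Complex.exp (Complex.I * ξ * t) * Complex.exp (-(Complex.I * ξ * t)) = 1 := by
    rw [← Complex.exp_add, add_neg_cancel, Complex.exp_zero]
  refine (h2.mul (h1.const_add c)).congr_deriv ?_
  linear_combination φ t * hee

/-- Duhamel's formula: existence of a solution with continuous right-hand side. -/
lemma exists_duhamel {s r C : ℝ} (hr : s - r ≤ s) {lam : ℤ × ℤ → ℝ} (hC : 0 ≤ C)
    (hlam : ∀ k, |lam k| ≤ C * (1 + len k) ^ r) {f : ℝ → Sobolev s} (hf : Continuous f)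
    (u₀ : Sobolev s) :
    ∃ (u : ℝ → Sobolev s) (d : ℝ → Sobolev (s - r)), Continuous u ∧ Continuous d ∧ u 0 = u₀ ∧
      (∀ t, HasDerivAt (fun τ => (u τ).incl hr) (d t) t) ∧
      (∀ t k, (d t).coeff k = Complex.I * lam k * (u t).coeff k + (f t).coeff k) ∧
      ∀ t k, (u t).coeff k = Complex.exp (Complex.I * lam k * t) *
        (u₀.coeff k + ∫ τ in (0 : ℝ)..t, Complex.exp (-(Complex.I * lam k * τ)) * (f τ).coeff k) := by
  -- Conjugating by the unitary group removes the unbounded generator: `W` is a plain integral in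
  -- `H^s`, and `u` is the group applied to `u₀ + W`.
  obtain ⟨g, hg, hcg⟩ := exists_continuous_diag
    (m := fun t k => Complex.exp (-(Complex.I * lam k * t)))
    zero_le_one (fun t k => (norm_exp_neg_I_mul _ _).le) (fun k => by fun_prop) hf
  obtain ⟨W, hWdef⟩ : ∃ W : ℝ → Sobolev s, ∀ t, W t = ∫ τ in (0 : ℝ)..t, g τ := ⟨_, fun _ => rfl⟩
  have hW : Continuous W := by
    refine continuous_iff_continuousAt.2 fun t => ?_
    rw [funext hWdef]
    exact (intervalIntegral.integral_hasDerivAt_right (hg.intervalIntegrable _ _)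
      (hg.stronglyMeasurableAtFilter _ _) hg.continuousAt).continuousAt
  have hcW : ∀ t k, (W t).coeff k
      = ∫ τ in (0 : ℝ)..t, Complex.exp (-(Complex.I * lam k * τ)) * (f τ).coeff k := by
    intro t k
    rw [hWdef, ← coeffCLM_apply,
      ← ContinuousLinearMap.intervalIntegral_comp_comm _ (hg.intervalIntegrable _ _)]
    simp only [coeffCLM_apply, hcg]
  obtain ⟨u, hu, hcu'⟩ := exists_continuous_diag (m := fun t k => Complex.exp (Complex.I * lam k * t))
    zero_le_one (fun t k => (norm_exp_I_mul _ _).le) (fun k => by fun_prop) (hW.const_add u₀)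
  obtain ⟨A, hA⟩ : ∃ A : Sobolev s →L[ℂ] Sobolev (s - r), ∀ v k,
      (A v).coeff k = Complex.I * lam k * v.coeff k := by
    refine ⟨weightedSubst id Function.injective_id (fun k => Complex.I * lam k) C hC fun k => ?_,
      fun v k => coeff_weightedSubst v k⟩
    rw [norm_mul, Complex.norm_I, one_mul, Complex.norm_real, Real.norm_eq_abs, id]
    calc |lam k| * (1 + len k) ^ (s - r) ≤ C * (1 + len k) ^ r * (1 + len k) ^ (s - r) :=
          mul_le_mul_of_nonneg_right (hlam k) (Real.rpow_nonneg (one_add_len_pos k).le _)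
      _ = C * (1 + len k) ^ s := by
          rw [mul_assoc, ← Real.rpow_add (one_add_len_pos k), add_sub_cancel]
  obtain ⟨d, hd, hcd⟩ : ∃ d : ℝ → Sobolev (s - r), Continuous d ∧
      ∀ t k, (d t).coeff k = Complex.I * lam k * (u t).coeff k + (f t).coeff k :=
    ⟨fun t => A (u t) + inclCLM hr (f t),
      (A.continuous.comp hu).add ((inclCLM hr).continuous.comp hf), fun t k => by
        rw [coeff_add, hA, inclCLM_apply, coeff_incl]⟩
  have hcu : ∀ t k, (u t).coeff k = Complex.exp (Complex.I * lam k * t) *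
        (u₀.coeff k + ∫ τ in (0 : ℝ)..t, Complex.exp (-(Complex.I * lam k * τ)) * (f τ).coeff k) := by
    intro t k
    rw [hcu', coeff_add, hcW]
  have hu0 : u 0 = u₀ := by
    ext k
    rw [hcu]
    simp
  have hscalar : ∀ t k, HasDerivAt (fun τ => (u τ).coeff k) ((d t).coeff k) t := by
    intro t k
    rw [hcd, hcu]
    exact (hasDerivAt_duhamel (lam k) (u₀.coeff k) ((continuous_coeff k).comp hf) t).congr_of_eventuallyEq
      (Filter.Eventually.of_forall fun τ => hcu τ k)
  -- Derivatives of single coefficients do not give a derivative in `H^{s-r}`. The integral identity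
  -- does, because `d` is continuous with values there.
  have hint : ∀ t, (u t).incl hr = u₀.incl hr + ∫ τ in (0 : ℝ)..t, d τ := by
    intro t
    ext k
    rw [coeff_add, ← coeffCLM_apply (s := s - r) k (∫ τ in (0 : ℝ)..t, d τ),
      ← ContinuousLinearMap.intervalIntegral_comp_comm _ (hd.intervalIntegrable _ _)]
    have h := intervalIntegral.integral_eq_sub_of_hasDerivAt (a := 0) (b := t)
      (fun τ _ => hscalar τ k) (((continuous_coeff k).comp hd).intervalIntegrable _ _)
    simp only [coeffCLM_apply]
    rw [h, hu0]
    simp [coeff_incl]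
  refine ⟨u, d, hu, hd, hu0, fun t => ?_, hcd, hcu⟩
  have h := (intervalIntegral.integral_hasDerivAt_right (hd.intervalIntegrable 0 t)
      (hd.stronglyMeasurableAtFilter _ _) hd.continuousAt).const_add (u₀.incl hr)
  exact h.congr_of_eventuallyEq (Filter.Eventually.of_forall hint)

lemma absolutelyContinuousOnInterval_of_hasDerivAt {E : Type*} [NormedAddCommGroup E]
    [NormedSpace ℝ E] {f d : ℝ → E} (hd : Continuous d) (h : ∀ t, HasDerivAt f (d t) t) (a b : ℝ) :
    AbsolutelyContinuousOnInterval f a b := by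
  obtain ⟨C, hC⟩ := (isCompact_uIcc (a := a) (b := b)).exists_bound_of_continuousOn hd.continuousOn
  have hC0 : 0 ≤ C := (norm_nonneg _).trans (hC a left_mem_uIcc)
  refine LipschitzOnWith.absolutelyContinuousOnInterval (K := ⟨C, hC0⟩) ?_
  exact (convex_uIcc a b).lipschitzOnWith_of_nnnorm_hasDerivWithin_le
    (fun t _ => (h t).hasDerivWithinAt) fun t ht => hC t ht

/-! ### Fourier coefficients of smooth periodic functions -/

/-- Integration by parts; periodicity cancels the boundary terms. -/
lemma integral_mul_exp_deriv {f : ℝ → ℂ} (hf : ContDiff ℝ 1 f) (hp : Function.Periodic f (2 * π))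
    (n : ℤ) : ∫ x in (0 : ℝ)..2 * π, deriv f x * Complex.exp (-(Complex.I * n * x))
      = Complex.I * n * ∫ x in (0 : ℝ)..2 * π, f x * Complex.exp (-(Complex.I * n * x)) := by
  have hfd : Differentiable ℝ f := hf.differentiable one_ne_zero
  have hfc : Continuous (deriv f) := hf.continuous_deriv le_rfl
  have hc := hf.continuous
  have hder : ∀ x : ℝ, HasDerivAt (fun x : ℝ => f x * Complex.exp (-(Complex.I * n * x)))
      (deriv f x * Complex.exp (-(Complex.I * n * x)) -
        Complex.I * n * (f x * Complex.exp (-(Complex.I * n * x)))) x := by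
    intro x
    have h0 : HasDerivAt (fun t : ℝ => (t : ℂ)) 1 x := Complex.ofRealCLM.hasDerivAt
    have he : HasDerivAt (fun t : ℝ => Complex.exp (-(Complex.I * n * t)))
        (Complex.exp (-(Complex.I * n * x)) * -(Complex.I * n * 1)) x :=
      ((h0.const_mul (Complex.I * n)).neg).cexp
    refine ((hfd x).hasDerivAt.mul he).congr_deriv ?_
    ring
  have h := intervalIntegral.integral_eq_sub_of_hasDerivAt (a := 0) (b := 2 * π)
    (fun x _ => hder x) (by apply Continuous.intervalIntegrable; fun_prop)
  have hend : f (2 * π) * Complex.exp (-(Complex.I * n * ((2 * π : ℝ) : ℂ)))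
      = f 0 * Complex.exp (-(Complex.I * n * ((0 : ℝ) : ℂ))) := by
    have h1 : f (2 * π) = f 0 := by simpa using hp 0
    have h2 : Complex.exp (-(Complex.I * n * ((2 * π : ℝ) : ℂ))) = 1 := by
      rw [Complex.exp_eq_one_iff]
      exact ⟨-n, by push_cast; ring⟩
    rw [h1, h2]
    simp
  rw [hend, sub_self, intervalIntegral.integral_sub, intervalIntegral.integral_const_mul] at h
  · exact sub_eq_zero.1 h
  · apply Continuous.intervalIntegrable; fun_prop
  · apply Continuous.intervalIntegrable; fun_prop

lemma exists_abs_pow_mul_integral_le (N : ℕ) : ∀ {f : ℝ → ℂ}, ContDiff ℝ ∞ f →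
    Function.Periodic f (2 * π) → ∃ C, ∀ n : ℤ,
      |(n : ℝ)| ^ N * ‖∫ x in (0 : ℝ)..2 * π, f x * Complex.exp (-(Complex.I * n * x))‖ ≤ C := by
  induction N with
  | zero =>
    intro f hf _
    obtain ⟨C, hC⟩ := (isCompact_uIcc (a := 0) (b := 2 * π)).exists_bound_of_continuousOn
      hf.continuous.continuousOn
    refine ⟨C * |2 * π - 0|, fun n => ?_⟩
    rw [pow_zero, one_mul]
    refine intervalIntegral.norm_integral_le_of_norm_le_const fun x hx => ?_
    have := norm_exp_neg_I_mul n x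
    rw [norm_mul, show Complex.I * n * x = Complex.I * ((n : ℝ) : ℂ) * x by push_cast; rfl, this,
      mul_one]
    exact hC x (uIoc_subset_uIcc hx)
  | succ N ih =>
    intro f hf hp
    have hd : ContDiff ℝ ∞ (deriv f) := (contDiff_infty_iff_deriv.1 hf).2
    have hdp : Function.Periodic (deriv f) (2 * π) := by
      intro x
      rw [← deriv_comp_add_const, show (fun y => f (y + 2 * π)) = f from funext hp]
    obtain ⟨C, hC⟩ := ih hd hdp
    refine ⟨C, fun n => ?_⟩
    have h := hC n
    rw [integral_mul_exp_deriv (hf.of_le (by exact_mod_cast le_top)) hp, norm_mul, norm_mul,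
      Complex.norm_I, one_mul] at h
    rw [pow_succ, mul_assoc]
    have hn : ‖(n : ℂ)‖ = |(n : ℝ)| := by
      rw [← Complex.ofReal_intCast, Complex.norm_real, Real.norm_eq_abs]
    rwa [hn] at h

lemma summable_int_one_add_abs : Summable fun n : ℤ => ((1 + |(n : ℝ)|) ^ 2)⁻¹ := by
  have h : Summable fun n : ℕ => ((1 + (n : ℝ)) ^ 2)⁻¹ := by
    have h1 := (summable_nat_add_iff 1).2 (Real.summable_nat_pow_inv.2 (one_lt_two : 1 < 2))
    refine h1.congr fun n => ?_
    push_cast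
    rw [add_comm]
  refine Summable.of_nat_of_neg (h.congr fun n => ?_) (h.congr fun n => ?_)
  · simp
  · simp

/-- The Fourier coefficients `(2π)⁻¹ ∫ e^{-inx} g(x) dx`. -/
def profileCoef (g : Torus → ℝ) (n : ℤ) : ℂ :=
  (1 / (2 * π) : ℂ) * ∫ x : Torus, fourier (-n) x * (g x : ℂ)

namespace IsProfile

variable {g : Torus → ℝ}

lemma continuous (hg : IsProfile g) : Continuous g :=
  (QuotientAddGroup.isQuotientMap_mk _).continuous_iff.2 hg.smooth.continuous

lemma profileCoef_zero (hg : IsProfile g) : profileCoef g 0 = 1 / (2 * π) := by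
  simp only [profileCoef, neg_zero, fourier_zero, one_mul]
  rw [integral_complex_ofReal, hg.integral_eq_one]
  simp

/-- Positivity and unit mass give a bound that is the same for all profiles. This is why the control
cost does not depend on `g₁, g₂`. -/
lemma norm_profileCoef_le (hg : IsProfile g) (n : ℤ) : ‖profileCoef g n‖ ≤ 1 / (2 * π) := by
  have h : ‖∫ x : Torus, fourier (-n) x * (g x : ℂ)‖ ≤ 1 := by
    refine (norm_integral_le_integral_norm _).trans (le_of_eq ?_)
    rw [← hg.integral_eq_one]
    congr 1
    ext x
    rw [norm_mul, Complex.norm_real, Real.norm_of_nonneg (hg.nonneg x), fourier_apply,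
      Circle.norm_coe, one_mul]
  rw [profileCoef, norm_mul]
  have h2 : ‖(1 / (2 * π) : ℂ)‖ = 1 / (2 * π) := by
    rw [show (1 / (2 * π) : ℂ) = ((1 / (2 * π) : ℝ) : ℂ) by push_cast; rfl, Complex.norm_real,
      Real.norm_of_nonneg (by positivity)]
  rw [h2]
  exact mul_le_of_le_one_right (by positivity) h

lemma profileCoef_eq_intervalIntegral (g : Torus → ℝ) (n : ℤ) : profileCoef g n
    = (1 / (2 * π) : ℂ) * ∫ x in (0 : ℝ)..2 * π, (g (x : Torus) : ℂ) *
      Complex.exp (-(Complex.I * n * x)) := by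
  have h := AddCircle.intervalIntegral_preimage (2 * π) 0
    (fun x : Torus => fourier (-n) x * (g x : ℂ))
  rw [zero_add] at h
  rw [profileCoef, ← h]
  congr 1
  refine intervalIntegral.integral_congr fun x _ => ?_
  simp only [fourier_coe_apply]
  rw [mul_comm]
  congr 2
  have hpi : (π : ℂ) ≠ 0 := Complex.ofReal_ne_zero.2 Real.pi_ne_zero
  push_cast
  field_simp

lemma summable_profileCoef (hg : IsProfile g) (s : ℝ) :
    Summable fun n : ℤ => ‖profileCoef g n‖ * (1 + |(n : ℝ)|) ^ s := by
  obtain ⟨N, hN⟩ := exists_nat_ge (s + 2)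
  have hsm : ContDiff ℝ ∞ (fun x : ℝ => (g (x : Torus) : ℂ)) :=
    Complex.ofRealCLM.contDiff.comp hg.smooth
  have hper : Function.Periodic (fun x : ℝ => (g (x : Torus) : ℂ)) (2 * π) := by
    intro x
    simp
  obtain ⟨C₀, hC₀⟩ := exists_abs_pow_mul_integral_le 0 hsm hper
  obtain ⟨C, hC⟩ := exists_abs_pow_mul_integral_le N hsm hper
  refine Summable.of_nonneg_of_le (fun n => by positivity) (fun n => ?_)
    (summable_int_one_add_abs.mul_left (2 ^ N * (C₀ + C)))
  set a : ℝ := |(n : ℝ)|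
  have ha : 0 ≤ a := abs_nonneg _
  set J : ℝ := ‖∫ x in (0 : ℝ)..2 * π, (g (x : Torus) : ℂ) * Complex.exp (-(Complex.I * n * x))‖
  have hJ : 0 ≤ J := norm_nonneg _
  have h1 : ‖profileCoef g n‖ ≤ J := by
    rw [profileCoef_eq_intervalIntegral, norm_mul]
    refine mul_le_of_le_one_left hJ ?_
    rw [show (1 / (2 * π) : ℂ) = ((1 / (2 * π) : ℝ) : ℂ) by push_cast; rfl, Complex.norm_real,
      Real.norm_of_nonneg (by positivity), div_le_one Real.two_pi_pos]
    linarith [Real.pi_gt_three]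
  have h2 : (1 + a) ^ N * J ≤ 2 ^ N * (C₀ + C) := by
    have h3 : (1 + a) ^ N ≤ 2 ^ N * (1 + a ^ N) := by
      rcases le_total a 1 with h | h
      · calc (1 + a) ^ N ≤ 2 ^ N := pow_le_pow_left₀ (by positivity) (by linarith) N
          _ ≤ 2 ^ N * (1 + a ^ N) := le_mul_of_one_le_right (by positivity)
            (le_add_of_nonneg_right (by positivity))
      · calc (1 + a) ^ N ≤ (2 * a) ^ N := pow_le_pow_left₀ (by positivity) (by linarith) N
          _ = 2 ^ N * a ^ N := mul_pow _ _ _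
          _ ≤ _ := by gcongr; linarith
    calc (1 + a) ^ N * J ≤ 2 ^ N * (1 + a ^ N) * J := by gcongr
      _ = 2 ^ N * (a ^ 0 * J + a ^ N * J) := by ring
      _ ≤ 2 ^ N * (C₀ + C) := by gcongr; exacts [hC₀ n, hC n]
  have h4 : (1 + a) ^ s * (1 + a) ^ 2 ≤ (1 + a) ^ N := by
    rw [← Real.rpow_natCast _ 2, ← Real.rpow_natCast _ N, ← Real.rpow_add (by positivity)]
    exact Real.rpow_le_rpow_of_exponent_le (by linarith) (by push_cast; exact hN)
  rw [← div_eq_mul_inv, le_div_iff₀ (by positivity), mul_assoc]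
  calc ‖profileCoef g n‖ * ((1 + a) ^ s * (1 + a) ^ 2) ≤ J * (1 + a) ^ N := by gcongr
    _ ≤ _ := by rw [mul_comm]; exact h2

end IsProfile

/-! ### Multiplication operators on `H^s` -/

lemma len_eq_norm (k : ℤ × ℤ) : len k = ‖(k.1 : ℂ) + k.2 * Complex.I‖ := by
  have := Complex.norm_add_mul_I (k.1 : ℝ) (k.2 : ℝ)
  push_cast at this
  exact this.symm

lemma len_nonneg (k : ℤ × ℤ) : 0 ≤ len k := Real.sqrt_nonneg _

lemma len_le_add (k e : ℤ × ℤ) : len k ≤ len (k - e) + len e := by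
  simp only [len_eq_norm]
  refine le_trans (le_of_eq ?_) (norm_add_le _ _)
  congr 1
  simp only [Prod.fst_sub, Prod.snd_sub]
  push_cast
  ring

/-- A Peetre-type inequality: shifting by `e` costs at most `(1 + |e|)^s` in the norm of `H^s`, `s ≥
0`. -/
lemma one_add_len_le (k e : ℤ × ℤ) : 1 + len k ≤ (1 + len e) * (1 + len (k - e)) := by
  nlinarith [len_le_add k e, mul_nonneg (len_nonneg e) (len_nonneg (k - e))]

/-- The operator `u ↦ m · ∑ₙ cₙ u(· - eₙ)` for rapidly decaying `c`. -/
lemma exists_convolution_clm {s : ℝ} (hs : 0 ≤ s) {c : ℤ → ℂ} {e : ℤ → ℤ × ℤ}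
    (hc : Summable fun n => ‖c n‖ * (1 + len (e n)) ^ s) {m : ℤ × ℤ → ℂ} (hm : ∀ k, ‖m k‖ ≤ 1) :
    ∃ L : Sobolev s →L[ℂ] Sobolev s, ∀ u k,
      HasSum (fun n => c n * (m k * u.coeff (k - e n))) ((L u).coeff k) := by
  have hbound : ∀ n k, ‖m k‖ * (1 + len k) ^ s ≤ (1 + len (e n)) ^ s * (1 + len (k - e n)) ^ s := by
    intro n k
    rw [← Real.mul_rpow (one_add_len_pos _).le (one_add_len_pos _).le]
    calc ‖m k‖ * (1 + len k) ^ s ≤ 1 * (1 + len k) ^ s :=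
          mul_le_mul_of_nonneg_right (hm k) (Real.rpow_nonneg (one_add_len_pos k).le _)
      _ ≤ _ := by
          rw [one_mul]
          exact Real.rpow_le_rpow (one_add_len_pos k).le (one_add_len_le k (e n)) hs
  let S : ℤ → Sobolev s →L[ℂ] Sobolev s := fun n => weightedSubst (fun k => k - e n)
    (sub_left_injective) m ((1 + len (e n)) ^ s) (Real.rpow_nonneg (one_add_len_pos _).le _)
    (hbound n)
  have hS : ∀ n, ‖S n‖ ≤ (1 + len (e n)) ^ s := fun n => norm_weightedSubst_le
  -- The series of weighted shifts converges absolutely in operator norm, the rapid decay of `c`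
  -- absorbing the shift costs.
  have hsum : Summable fun n => c n • S n := by
    refine Summable.of_norm_bounded hc fun n => ?_
    rw [norm_smul]
    exact mul_le_mul_of_nonneg_left (hS n) (norm_nonneg _)
  refine ⟨∑' n, c n • S n, fun u k => ?_⟩
  have h1 := hsum.hasSum.mapL (ContinuousLinearMap.apply ℂ (Sobolev s) u)
  have h2 := h1.mapL (coeffCLM s k)
  refine h2.congr_fun fun n => ?_
  simp only [S, ContinuousLinearMap.apply_apply, smul_apply, coeffCLM_apply,
    coeff_smul, coeff_weightedSubst]

/-! ### Fourier coefficients of the control operator -/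

/-- `e^{-ik·x}`. -/
def conjChar (k : ℤ × ℤ) (p : Torus × Torus) : ℂ := fourier (-k.1) p.1 * fourier (-k.2) p.2

lemma continuous_conjChar (k : ℤ × ℤ) : Continuous (conjChar k) := by
  unfold conjChar
  fun_prop

/-- The indicator of a non-zero integer. -/
def nz (n : ℤ) : ℂ := if n = 0 then 0 else 1

lemma norm_nz_le (n : ℤ) : ‖nz n‖ ≤ 1 := by
  unfold nz
  split_ifs <;> simp

lemma integrable_mul_of_continuous {φ : Torus × Torus → ℂ} (hφ : Integrable φ)
    {K : Torus × Torus → ℂ} (hK : Continuous K) : Integrable fun p => K p * φ p := by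
  obtain ⟨C, hC⟩ := isCompact_univ.exists_bound_of_continuousOn hK.continuousOn
  exact hφ.bdd_mul hK.aestronglyMeasurable (Filter.Eventually.of_forall fun p => hC p (mem_univ p))

/-- The average in `x` does not depend on `x`, so only modes with `k₁ = 0` see it, where `1 - nz k.1
= 1`; Fubini identifies the remaining integral. -/
lemma integral_fst_average {φ : Torus × Torus → ℂ} (hφ : Integrable φ) {g : Torus → ℝ}
    (hg : Continuous g) (k : ℤ × ℤ) :
    Integrable (fun p : Torus × Torus => conjChar k p * (g p.2 * ∫ x', φ (x', p.2))) ∧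
    ∫ p : Torus × Torus, conjChar k p * (g p.2 * ∫ x', φ (x', p.2))
      = 2 * π * (1 - nz k.1) * ∫ p : Torus × Torus, conjChar k p * (g p.2 * φ p) := by
  have hφ' : Integrable φ ((volume : Measure Torus).prod volume) := hφ
  let B : Torus → ℂ := fun y => fourier (-k.2) y * g y * ∫ x', φ (x', y)
  have hBint : Integrable B := by
    have h1 : Integrable fun y => ∫ x', φ (x', y) := hφ'.integral_prod_right
    have hK : Continuous fun y : Torus => (fourier (-k.2) y : ℂ) * g y := by fun_prop
    obtain ⟨C, hC⟩ := isCompact_univ.exists_bound_of_continuousOn hK.continuousOn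
    exact h1.bdd_mul hK.aestronglyMeasurable (Filter.Eventually.of_forall fun p => hC p (mem_univ p))
  have hAint : Integrable (fun x : Torus => (fourier (-k.1) x : ℂ)) :=
    (fourier (-k.1)).continuous.integrable_of_hasCompactSupport (HasCompactSupport.of_compactSpace _)
  have heq : ∀ p : Torus × Torus, conjChar k p * (g p.2 * ∫ x', φ (x', p.2))
      = fourier (-k.1) p.1 * B p.2 := by
    intro p
    simp only [conjChar, B]
    ring
  simp_rw [heq]
  refine ⟨hAint.mul_prod hBint, ?_⟩
  rw [Measure.volume_eq_prod, integral_prod_mul (fun x : Torus => (fourier (-k.1) x : ℂ)) B,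
    integral_fourier, nz]
  by_cases hk : k.1 = 0
  · simp only [hk, neg_zero, if_true, sub_zero, mul_one]
    congr 1
    have hint : Integrable (fun p : Torus × Torus => conjChar k p * (g p.2 * φ p))
        ((volume : Measure Torus).prod volume) := by
      have hK : Continuous fun p : Torus × Torus => conjChar k p * g p.2 := by
        have := continuous_conjChar k
        fun_prop
      refine (integrable_mul_of_continuous hφ hK).congr (Filter.Eventually.of_forall fun p => ?_)
      simp only [mul_assoc]
    rw [integral_prod_symm _ hint]
    congr 1
    ext y
    simp only [B, ← integral_const_mul]
    congr 1
    ext x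
    simp only [conjChar, hk, neg_zero, fourier_zero]
    ring
  · simp [hk]

lemma integral_swap_torus {E : Type*} [NormedAddCommGroup E] [NormedSpace ℝ E]
    (F : Torus × Torus → E) : ∫ p : Torus × Torus, F p.swap = ∫ p, F p := by
  rw [Measure.volume_eq_prod]
  exact integral_prod_swap F

/-- The previous average with the two variables exchanged. -/
lemma integral_snd_average {φ : Torus × Torus → ℂ} (hφ : Integrable φ) {g : Torus → ℝ}
    (hg : Continuous g) (k : ℤ × ℤ) :
    Integrable (fun p : Torus × Torus => conjChar k p * (g p.1 * ∫ y', φ (p.1, y'))) ∧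
    ∫ p : Torus × Torus, conjChar k p * (g p.1 * ∫ y', φ (p.1, y'))
      = 2 * π * (1 - nz k.2) * ∫ p : Torus × Torus, conjChar k p * (g p.1 * φ p) := by
  have hφ' : Integrable φ ((volume : Measure Torus).prod volume) := hφ
  have hchar : ∀ p : Torus × Torus, conjChar k.swap p.swap = conjChar k p := fun p => by
    simp only [conjChar, Prod.fst_swap, Prod.snd_swap]
    ring
  obtain ⟨h1, h2⟩ := integral_fst_average (φ := fun p => φ p.swap) hφ'.swap hg k.swap
  have h1' : Integrable (fun p : Torus × Torus => conjChar k.swap p * (g p.2 * ∫ x', φ (p.2, x')))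
    ((volume : Measure Torus).prod volume) := h1
  refine ⟨?_, ?_⟩
  · refine (h1'.swap).congr (Filter.Eventually.of_forall fun p => ?_)
    simp only [Function.comp_apply, hchar, Prod.snd_swap]
  · rw [← integral_swap_torus, ← integral_swap_torus (fun p => conjChar k.swap p * _)] at h2
    simpa only [hchar, Prod.snd_swap, Prod.fst_swap, Prod.swap_swap, Prod.swap_prod_mk] using h2

/-- The kernel representing `φ ↦ (Gφ)^(k)`. -/
def controlKernel (g₁ g₂ : Torus → ℝ) (k : ℤ × ℤ) (p : Torus × Torus) : ℂ :=
  conjChar k p * (nz k.1 * g₂ p.2 + nz k.2 * g₁ p.1)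

/-- The subtracted means cancel the modes with `k₁ = 0` in the first term and with `k₂ = 0` in the
second, turning the two averages into the factors `nz`. -/
lemma fourierCoef_opG {g₁ g₂ : Torus → ℝ} (hg₁ : Continuous g₁) (hg₂ : Continuous g₂)
    {φ : Torus × Torus → ℂ} (hφ : Integrable φ) (k : ℤ × ℤ) :
    fourierCoef (opG g₁ g₂ φ) k
      = (1 / (2 * π) ^ 3 : ℂ) * ∫ p : Torus × Torus, controlKernel g₁ g₂ k p * φ p := by
  have hpi : (π : ℂ) ≠ 0 := Complex.ofReal_ne_zero.2 Real.pi_ne_zero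
  obtain ⟨ha1, ha2⟩ := integral_fst_average hφ hg₂ k
  obtain ⟨hb1, hb2⟩ := integral_snd_average hφ hg₁ k
  have hcc := continuous_conjChar k
  have hc1 : Integrable fun p : Torus × Torus => conjChar k p * (g₂ p.2 * φ p) := by
    refine (integrable_mul_of_continuous hφ (K := fun p => conjChar k p * g₂ p.2)
      (by fun_prop)).congr (Filter.Eventually.of_forall fun p => ?_)
    simp only [mul_assoc]
  have hc2 : Integrable fun p : Torus × Torus => conjChar k p * (g₁ p.1 * φ p) := by
    refine (integrable_mul_of_continuous hφ (K := fun p => conjChar k p * g₁ p.1)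
      (by fun_prop)).congr (Filter.Eventually.of_forall fun p => ?_)
    simp only [mul_assoc]
  have hL : ∀ p : Torus × Torus, fourier (-k.1) p.1 * fourier (-k.2) p.2 * opG g₁ g₂ φ p
      = ((1 / (2 * π) : ℂ) * (conjChar k p * (g₂ p.2 * φ p))
          - (1 / (2 * π) ^ 2 : ℂ) * (conjChar k p * (g₂ p.2 * ∫ x', φ (x', p.2))))
        + ((1 / (2 * π) : ℂ) * (conjChar k p * (g₁ p.1 * φ p))
          - (1 / (2 * π) ^ 2 : ℂ) * (conjChar k p * (g₁ p.1 * ∫ y', φ (p.1, y')))) := by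
    intro p
    simp only [opG, opG1, opG2, conjChar]
    ring
  have hR : ∀ p : Torus × Torus, controlKernel g₁ g₂ k p * φ p
      = nz k.1 * (conjChar k p * (g₂ p.2 * φ p)) + nz k.2 * (conjChar k p * (g₁ p.1 * φ p)) := by
    intro p
    simp only [controlKernel]
    ring
  unfold fourierCoef
  simp_rw [hL, hR]
  have hs1 : Integrable fun p : Torus × Torus => (1 / (2 * π) : ℂ) * (conjChar k p * (g₂ p.2 * φ p))
      - (1 / (2 * π) ^ 2 : ℂ) * (conjChar k p * (g₂ p.2 * ∫ x', φ (x', p.2))) :=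
    (hc1.const_mul _).sub (ha1.const_mul _)
  have hs2 : Integrable fun p : Torus × Torus => (1 / (2 * π) : ℂ) * (conjChar k p * (g₁ p.1 * φ p))
      - (1 / (2 * π) ^ 2 : ℂ) * (conjChar k p * (g₁ p.1 * ∫ y', φ (p.1, y'))) :=
    (hc2.const_mul _).sub (hb1.const_mul _)
  rw [integral_add hs1 hs2, integral_sub (hc1.const_mul _) (ha1.const_mul _), integral_sub (hc2.const_mul _) (hb1.const_mul _),
    integral_add (hc1.const_mul _) (hc2.const_mul _)]
  simp only [integral_const_mul, ha2, hb2]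
  field_simp
  ring

lemma integral_controlKernel_psi (g₁ g₂ : Torus → ℝ) (hg₁ : Continuous g₁) (hg₂ : Continuous g₂)
    (j k : ℤ × ℤ) : ∫ p : Torus × Torus, controlKernel g₁ g₂ k p * psi j p
      = 2 * π * (nz k.1 * (if j.1 = k.1 then profileCoef g₂ (k.2 - j.2) else 0)
        + nz k.2 * (if j.2 = k.2 then profileCoef g₁ (k.1 - j.1) else 0)) := by
  have hpi : (π : ℂ) ≠ 0 := Complex.ofReal_ne_zero.2 Real.pi_ne_zero
  have hfi : ∀ n : ℤ, Integrable (fun x : Torus => (fourier n x : ℂ)) := fun n =>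
    (fourier n).continuous.integrable_of_hasCompactSupport (HasCompactSupport.of_compactSpace _)
  have hgi : ∀ (n : ℤ) {g : Torus → ℝ}, Continuous g →
      Integrable (fun x : Torus => (fourier n x : ℂ) * g x) := fun n g hg =>
    Continuous.integrable_of_hasCompactSupport (by fun_prop) (HasCompactSupport.of_compactSpace _)
  have hcoef : ∀ (g : Torus → ℝ) (n : ℤ), ∫ x : Torus, (fourier (-n) x : ℂ) * g x
      = 2 * π * profileCoef g n := by
    intro g n
    rw [profileCoef]
    field_simp
  have h : ∀ p : Torus × Torus, controlKernel g₁ g₂ k p * psi j p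
      = (nz k.1 / (2 * π)) * (fourier (j.1 - k.1) p.1 * (fourier (-(k.2 - j.2)) p.2 * g₂ p.2))
        + (nz k.2 / (2 * π)) * ((fourier (-(k.1 - j.1)) p.1 * g₁ p.1) * fourier (j.2 - k.2) p.2) := by
    intro p
    have e : ∀ (a c : ℤ) (x : Torus), (fourier (-(a - c)) x : ℂ) = fourier (-a) x * fourier c x := by
      intro a c x
      rw [← fourier_add, neg_sub, neg_add_eq_sub]
    have e' : ∀ (a c : ℤ) (x : Torus), (fourier (c - a) x : ℂ) = fourier (-a) x * fourier c x := by
      intro a c x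
      rw [← fourier_add, neg_add_eq_sub]
    simp only [controlKernel, conjChar, psi, ContinuousMap.coe_mk, e, e']
    ring
  simp_rw [h]
  rw [Measure.volume_eq_prod, integral_add (((hfi _).mul_prod (hgi _ hg₂)).const_mul _)
    (((hgi _ hg₁).mul_prod (hfi _)).const_mul _), integral_const_mul, integral_const_mul,
    integral_prod_mul (fun x : Torus => (fourier (j.1 - k.1) x : ℂ))
      (fun y : Torus => (fourier (-(k.2 - j.2)) y : ℂ) * g₂ y),
    integral_prod_mul (fun x : Torus => (fourier (-(k.1 - j.1)) x : ℂ) * g₁ x)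
      (fun y : Torus => (fourier (j.2 - k.2) y : ℂ)),
    integral_fourier, integral_fourier, hcoef, hcoef]
  simp only [sub_eq_zero]
  by_cases h1 : j.1 = k.1 <;> by_cases h2 : j.2 = k.2 <;> simp [h1, h2] <;> field_simp

/-- `φ ↦ ∫ K φ` as a functional on `L²`. -/
lemma exists_integral_functional {K : Torus × Torus → ℂ} (hK : Continuous K) :
    ∃ ℓ : Lp ℂ 2 (volume : Measure (Torus × Torus)) →L[ℂ] ℂ, ∀ f, ℓ f = ∫ p, K p * f p := by
  let κ : C(Torus × Torus, ℂ) := ⟨fun p => starRingEnd ℂ (K p), by fun_prop⟩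
  refine ⟨innerSL ℂ (ContinuousMap.toLp 2 volume ℂ κ), fun f => ?_⟩
  rw [innerSL_apply_apply, L2.inner_def]
  refine integral_congr_ae ?_
  filter_upwards [ContinuousMap.coeFn_toLp (p := 2) (𝕜 := ℂ) volume κ] with p hp
  rw [hp]
  simp only [RCLike.inner_apply, κ, ContinuousMap.coe_mk, Complex.conj_conj]
  ring

lemma continuous_controlKernel {g₁ g₂ : Torus → ℝ} (hg₁ : Continuous g₁) (hg₂ : Continuous g₂)
    (k : ℤ × ℤ) : Continuous (controlKernel g₁ g₂ k) := by
  have := continuous_conjChar k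
  unfold controlKernel
  fun_prop

/-- For fixed `k` the coefficient is a continuous functional on `L²`, so it passes through the
Fourier series of `u`. -/
lemma hasSum_fourierCoef_opG {s : ℝ} (hs : 0 ≤ s) {g₁ g₂ : Torus → ℝ} (hg₁ : Continuous g₁)
    (hg₂ : Continuous g₂) (u : Sobolev s) (k : ℤ × ℤ) :
    HasSum (fun j : ℤ × ℤ => (1 / (2 * π) : ℂ) * u.coeff j *
        (nz k.1 * (if j.1 = k.1 then profileCoef g₂ (k.2 - j.2) else 0)
        + nz k.2 * (if j.2 = k.2 then profileCoef g₁ (k.1 - j.1) else 0)))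
      (fourierCoef (opG g₁ g₂ u.toL2) k) := by
  have hpi : (π : ℂ) ≠ 0 := Complex.ofReal_ne_zero.2 Real.pi_ne_zero
  obtain ⟨ℓ, hℓ⟩ := exists_integral_functional (continuous_controlKernel hg₁ hg₂ k)
  have hint : Integrable (u.toL2 : Torus × Torus → ℂ) :=
    (Lp.memLp u.toL2).integrable (by norm_num)
  rw [fourierCoef_opG hg₁ hg₂ hint, ← hℓ]
  refine (((hasSum_toL2 hs u).mapL ℓ).mul_left (1 / (2 * π) ^ 3 : ℂ)).congr_fun fun j => ?_
  have hψ : ℓ (ContinuousMap.toLp 2 volume ℂ (psi j)) = _ := (hℓ _).trans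
    ((integral_congr_ae (by
      filter_upwards [ContinuousMap.coeFn_toLp (p := 2) (𝕜 := ℂ) volume (psi j)] with p hp
      rw [hp])).trans (integral_controlKernel_psi g₁ g₂ hg₁ hg₂ j k))
  rw [map_smul, hψ, smul_eq_mul]
  field_simp

/-- The control operator is bounded on `H^s`. -/
lemma exists_controlOp {s : ℝ} (hs : 0 ≤ s) {g₁ g₂ : Torus → ℝ} (hg₁ : IsProfile g₁)
    (hg₂ : IsProfile g₂) : ∃ G : Sobolev s →L[ℂ] Sobolev s, ∀ u k,
      (G u).coeff k = fourierCoef (opG g₁ g₂ u.toL2) k := by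
  have hlen2 : ∀ n : ℤ, len (0, n) = |(n : ℝ)| := fun n => by simp [len, Real.sqrt_sq_eq_abs]
  have hlen1 : ∀ n : ℤ, len (n, 0) = |(n : ℝ)| := fun n => by simp [len, Real.sqrt_sq_eq_abs]
  obtain ⟨L₂, hL₂⟩ := exists_convolution_clm hs (c := profileCoef g₂) (e := fun n => (0, n))
    (by simpa only [hlen2] using hg₂.summable_profileCoef s) (m := fun k => nz k.1)
    (fun k => norm_nz_le _)
  obtain ⟨L₁, hL₁⟩ := exists_convolution_clm hs (c := profileCoef g₁) (e := fun n => (n, 0))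
    (by simpa only [hlen1] using hg₁.summable_profileCoef s) (m := fun k => nz k.2)
    (fun k => norm_nz_le _)
  refine ⟨(1 / (2 * π) : ℂ) • (L₂ + L₁), fun u k => ?_⟩
  have h := hasSum_fourierCoef_opG hs hg₁.continuous hg₂.continuous u k
  have h2 : HasSum (fun j : ℤ × ℤ => nz k.1 * u.coeff j *
      (if j.1 = k.1 then profileCoef g₂ (k.2 - j.2) else 0)) ((L₂ u).coeff k) := by
    have hinj : Function.Injective fun n : ℤ => ((k.1, k.2 - n) : ℤ × ℤ) := fun a c hac => by
      simpa using hac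
    rw [← hinj.hasSum_iff]
    · refine (hL₂ u k).congr_fun fun n => ?_
      have : k - (0, n) = (k.1, k.2 - n) := by ext <;> simp
      simp only [Function.comp_apply, if_true, this, sub_sub_cancel]
      ring
    · intro j hj
      rw [if_neg, mul_zero]
      intro h1
      exact hj ⟨k.2 - j.2, by ext <;> simp [h1]⟩
  have h1 : HasSum (fun j : ℤ × ℤ => nz k.2 * u.coeff j *
      (if j.2 = k.2 then profileCoef g₁ (k.1 - j.1) else 0)) ((L₁ u).coeff k) := by
    have hinj : Function.Injective fun n : ℤ => ((k.1 - n, k.2) : ℤ × ℤ) := fun a c hac => by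
      simpa using hac
    rw [← hinj.hasSum_iff]
    · refine (hL₁ u k).congr_fun fun n => ?_
      have : k - (n, 0) = (k.1 - n, k.2) := by ext <;> simp
      simp only [Function.comp_apply, if_true, this, sub_sub_cancel]
      ring
    · intro j hj
      rw [if_neg, mul_zero]
      intro h1
      exact hj ⟨k.1 - j.1, by ext <;> simp [h1]⟩
  refine HasSum.unique ?_ h
  rw [smul_apply, add_apply, coeff_smul, coeff_add]
  refine ((h2.add h1).mul_left _).congr_fun fun j => ?_
  ring

/-! ### The control operator on a single eigenspace -/

/-- The reflection `(k₁, k₂) ↦ (k₁, -k₂)`. -/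
def flipSnd (k : ℤ × ℤ) : ℤ × ℤ := (k.1, -k.2)

lemma flipSnd_injective : Function.Injective flipSnd := by
  intro j k h
  simp only [flipSnd, Prod.mk.injEq, neg_inj] at h
  exact Prod.ext h.1 h.2

lemma len_flipSnd (k : ℤ × ℤ) : len (flipSnd k) = len k := by
  simp [len, flipSnd]

lemma flipSnd_flipSnd (k : ℤ × ℤ) : flipSnd (flipSnd k) = k := by
  simp [flipSnd]

/-- On an eigenspace of `∂ₓL` the compression of the control operator only couples `k` with its
reflection. -/
lemma fourierCoef_opG_of_eigen {s : ℝ} (hs : 0 ≤ s) {lam : ℤ × ℤ → ℝ} (h3 : OddEvenHyp lam)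
    {g₁ g₂ : Torus → ℝ} (hg₁ : IsProfile g₁) (hg₂ : IsProfile g₂) (k : ℤ × ℤ) (w : Sobolev s)
    (hw : ∀ j, lam j ≠ lam k → w.coeff j = 0) :
    fourierCoef (opG g₁ g₂ w.toL2) k = (1 / (2 * π) : ℂ) ^ 2 *
      ((nz k.1 + nz k.2) * w.coeff k
        + nz k.1 * nz k.2 * (2 * π * profileCoef g₂ (2 * k.2)) * w.coeff (flipSnd k)) := by
  have hpi : (π : ℂ) ≠ 0 := Complex.ofReal_ne_zero.2 Real.pi_ne_zero
  have h := hasSum_fourierCoef_opG hs hg₁.continuous hg₂.continuous w k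
  -- A contributing `j` has the eigenvalue of `k` and shares a coordinate with it. When that
  -- coordinate is zero, uniqueness may fail, but then the corresponding factor `nz` vanishes.
  have hzero : ∀ j, j ∉ ({k, flipSnd k} : Finset (ℤ × ℤ)) → (1 / (2 * π) : ℂ) * w.coeff j *
      (nz k.1 * (if j.1 = k.1 then profileCoef g₂ (k.2 - j.2) else 0)
        + nz k.2 * (if j.2 = k.2 then profileCoef g₁ (k.1 - j.1) else 0)) = 0 := by
    intro j hj
    simp only [Finset.mem_insert, Finset.mem_singleton, not_or] at hj
    by_cases hlam : lam j = lam k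
    · have e1 : nz k.1 * (if j.1 = k.1 then profileCoef g₂ (k.2 - j.2) else 0) = 0 := by
        by_cases hk1 : k.1 = 0
        · simp [nz, hk1]
        · rw [if_neg, mul_zero]
          intro hjk
          have hjk' : lam (k.1, j.2) = lam (k.1, k.2) := by
            rw [show (k.1, j.2) = j from Prod.ext hjk.symm rfl]
            exact hlam
          rcases (h3.unique_snd k.1 k.2 hk1 j.2).1 hjk' with h' | h'
          · exact hj.1 (Prod.ext hjk h')
          · exact hj.2 (Prod.ext hjk h')
      have e2 : nz k.2 * (if j.2 = k.2 then profileCoef g₁ (k.1 - j.1) else 0) = 0 := by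
        by_cases hk2 : k.2 = 0
        · simp [nz, hk2]
        · rw [if_neg, mul_zero]
          intro hjk
          have hjk' : lam (j.1, k.2) = lam (k.1, k.2) := by
            rw [show (j.1, k.2) = j from Prod.ext rfl hjk.symm]
            exact hlam
          exact hj.1 (Prod.ext ((h3.unique_fst k.1 k.2 hk2 j.1).1 hjk') hjk)
      rw [e1, e2, add_zero, mul_zero]
    · rw [hw j hlam]
      ring
  have heq := h.unique (hasSum_sum_of_ne_finset_zero hzero)
  rw [heq]
  -- On this axis `k` is its own reflection, and the pair collapses to one index.
  by_cases hk2 : k.2 = 0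
  · have hflip : flipSnd k = k := Prod.ext rfl (by simp [flipSnd, hk2])
    rw [hflip, Finset.pair_eq_singleton, Finset.sum_singleton]
    simp only [if_true, sub_self, hg₁.profileCoef_zero, hg₂.profileCoef_zero, nz, hk2]
    ring
  · have hflip : k ≠ flipSnd k := by
      intro h'
      have := congrArg Prod.snd h'
      simp only [flipSnd] at this
      omega
    have hne : ¬ (-k.2 = k.2) := by omega
    rw [Finset.sum_pair hflip]
    simp only [if_true, sub_self, hg₁.profileCoef_zero, hg₂.profileCoef_zero, flipSnd, hne, if_false,
      sub_neg_eq_add, ← two_mul, nz, hk2]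
    field_simp
    ring

/-- Both factors `nz` vanish, so the control cannot change the mean; hence the condition on the
means of `u₀` and `u₁`. -/
lemma fourierCoef_opG_zero {s : ℝ} (hs : 0 ≤ s) {g₁ g₂ : Torus → ℝ} (hg₁ : IsProfile g₁)
    (hg₂ : IsProfile g₂) (w : Sobolev s) : fourierCoef (opG g₁ g₂ w.toL2) (0, 0) = 0 := by
  have h := hasSum_fourierCoef_opG hs hg₁.continuous hg₂.continuous w (0, 0)
  simp only [nz, if_true, zero_mul, add_zero, mul_zero] at h
  exact h.unique hasSum_zero

/-- The block-diagonal part of the control operator is invertible modulo the mean, with bounds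
independent of the control profiles. -/
lemma exists_block_inverse {s : ℝ} {β : ℤ → ℂ} (hβ : ∀ n, ‖β n‖ ≤ 1) (z : Sobolev s) :
    ∃ v : Sobolev s, ‖v‖ ≤ 2 * (2 * π) ^ 2 * ‖z‖ ∧ ∀ k, k ≠ (0, 0) →
      (1 / (2 * π) : ℂ) ^ 2 * ((nz k.1 + nz k.2) * v.coeff k
        + nz k.1 * nz k.2 * β k.2 * v.coeff (flipSnd k)) = z.coeff k := by
  have hpi : (π : ℂ) ≠ 0 := Complex.ofReal_ne_zero.2 Real.pi_ne_zero
  have hpi2 : (0 : ℝ) ≤ (2 * π) ^ 2 := by positivity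
  have hnpi : ‖((2 * π) ^ 2 : ℂ)‖ = (2 * π) ^ 2 := by
    rw [show ((2 * π) ^ 2 : ℂ) = (((2 * π) ^ 2 : ℝ) : ℂ) by push_cast; rfl, Complex.norm_real,
      Real.norm_of_nonneg hpi2]
  -- Off the axes, `k` and its reflection satisfy a system with matrix `(2π)⁻² [[2, β(k₂)], [β(-k₂),
  -- 2]]`; this is its determinant up to the scalar factor.
  have hdet : ∀ n, 3 ≤ ‖4 - β n * β (-n)‖ := by
    intro n
    have h1 : ‖β n * β (-n)‖ ≤ 1 := by
      rw [norm_mul]; exact mul_le_one₀ (hβ _) (norm_nonneg _) (hβ _)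
    have h2 := norm_sub_norm_le (4 : ℂ) (β n * β (-n))
    have h4 : ‖(4 : ℂ)‖ = 4 := by simp
    rw [h4] at h2
    linarith
  -- `m₁` and `m₂` are the diagonal and off-diagonal entries of the inverse matrix. On the axes the
  -- equation is scalar, with coefficient `(2π)⁻²`.
  let m₁ : ℤ × ℤ → ℂ := fun k => (2 * π) ^ 2 *
    (if k.1 = 0 ∨ k.2 = 0 then 1 else 2 / (4 - β k.2 * β (-k.2)))
  let m₂ : ℤ × ℤ → ℂ := fun k => (2 * π) ^ 2 *
    (if k.1 = 0 ∨ k.2 = 0 then 0 else -β k.2 / (4 - β k.2 * β (-k.2)))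
  have hm₁ : ∀ k, ‖m₁ k‖ ≤ (2 * π) ^ 2 := by
    intro k
    simp only [m₁]
    rw [norm_mul, hnpi]
    refine mul_le_of_le_one_right hpi2 ?_
    split_ifs
    · simp
    · rw [norm_div, div_le_one (by linarith [hdet k.2])]
      have : ‖(2 : ℂ)‖ = 2 := by simp
      linarith [hdet k.2]
  have hm₂ : ∀ k, ‖m₂ k‖ ≤ (2 * π) ^ 2 := by
    intro k
    simp only [m₂]
    rw [norm_mul, hnpi]
    refine mul_le_of_le_one_right hpi2 ?_
    split_ifs
    · simp
    · rw [norm_div, norm_neg, div_le_one (by linarith [hdet k.2])]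
      linarith [hdet k.2, hβ k.2]
  let D₁ : Sobolev s →L[ℂ] Sobolev s := diag m₁ _ hpi2 hm₁
  let D₂ : Sobolev s →L[ℂ] Sobolev s := weightedSubst flipSnd flipSnd_injective m₂ _ hpi2 fun k => by
    rw [len_flipSnd]
    exact mul_le_mul_of_nonneg_right (hm₂ k) (Real.rpow_nonneg (one_add_len_pos k).le _)
  have hcoef : ∀ k, (D₁ z + D₂ z).coeff k = m₁ k * z.coeff k + m₂ k * z.coeff (flipSnd k) := by
    intro k
    simp only [D₁, D₂, coeff_add, coeff_diag, coeff_weightedSubst]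
  refine ⟨D₁ z + D₂ z, ?_, fun k hk => ?_⟩
  · have h1 : ‖D₁ z‖ ≤ (2 * π) ^ 2 * ‖z‖ := norm_diag_apply_le z
    have h2 : ‖D₂ z‖ ≤ (2 * π) ^ 2 * ‖z‖ := norm_weightedSubst_apply_le z
    linarith [norm_add_le (D₁ z) (D₂ z)]
  · rw [hcoef, hcoef, flipSnd_flipSnd]
    simp only [m₁, m₂, flipSnd, neg_neg, neg_eq_zero]
    by_cases h1 : k.1 = 0
    · have h2 : k.2 ≠ 0 := fun h2 => hk (Prod.ext h1 h2)
      simp only [nz, h1, h2, true_or, if_true, if_false]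
      field_simp
      ring
    · by_cases h2 : k.2 = 0
      · simp only [nz, h1, h2, or_true, if_true, if_false]
        field_simp
        ring
      · have hd : 4 - β k.2 * β (-k.2) ≠ 0 := norm_pos_iff.1 (by linarith [hdet k.2])
        simp only [nz, h1, h2, or_self, if_false, mul_comm (β (-k.2)) (β k.2)]
        field_simp
        ring

/-! ### The frequencies -/

/-- An eigenvalue missed by `I` could be adjoined to it, against maximality. -/
lemma range_eq_image_of_isMaximalDistinct {lam : ℤ × ℤ → ℝ} {I : Set (ℤ × ℤ)}
    (hI : IsMaximalDistinct lam I) : range lam = lam '' I := by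
  refine Subset.antisymm ?_ (image_subset_range _ _)
  rintro _ ⟨k, rfl⟩
  by_contra hk
  have hkI : k ∉ I := fun h => hk (mem_image_of_mem _ h)
  have hins : InjOn lam (insert k I) := (injOn_insert hkI).2 ⟨hI.prop, hk⟩
  exact hkI (hI.le_of_ge hins (subset_insert _ _) (mem_insert _ _))

lemma isSeparatedBy_image_of_lt_gap {lam : ℤ × ℤ → ℝ} {A : Set (ℤ × ℤ)} {g : ℝ}
    (hg : ENNReal.ofReal g ≤ gap lam A) : IsSeparatedBy (lam '' A) g := by
  rintro _ ⟨k, hk, rfl⟩ _ ⟨k', hk', rfl⟩ hne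
  have hkk : k ≠ k' := fun h => hne (by rw [h])
  have h : gap lam A ≤ ENNReal.ofReal |lam k - lam k'| :=
    iInf_le_of_le k (iInf_le_of_le hk (iInf_le_of_le k' (iInf_le_of_le hk' (iInf_le _ hkk))))
  exact (ENNReal.ofReal_le_ofReal_iff (abs_nonneg _)).1 (hg.trans h)

lemma exists_separation {lam : ℤ × ℤ → ℝ} {I : Set (ℤ × ℤ)} (hI : IsMaximalDistinct lam I)
    (hgap : 0 < gap lam I) {T : ℝ}
    (hT : ENNReal.ofReal (2 * π) / asymptoticGap lam I < ENNReal.ofReal T) :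
    ∃ γ > 0, IsSeparatedBy (range lam) γ ∧ ∃ (F : Finset ℝ) (g : ℝ), 0 < g ∧
      IsSeparatedBy (range lam \ F) g ∧ 2 * π < g * T := by
  have hT0 : 0 < T := ENNReal.ofReal_pos.1 (pos_of_gt hT)
  have hrange := range_eq_image_of_isMaximalDistinct hI
  -- The gap may be infinite, so a finite positive number below it is chosen; likewise for `g`
  -- below.
  obtain ⟨γ, hγ0, hγ⟩ := ENNReal.lt_iff_exists_nnreal_btwn.1 hgap
  refine ⟨γ, by exact_mod_cast hγ0, ?_, ?_⟩
  · rw [hrange]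
    exact isSeparatedBy_image_of_lt_gap (by rw [ENNReal.ofReal_coe_nnreal]; exact hγ.le)
  have hlt : ENNReal.ofReal (2 * π / T) < asymptoticGap lam I := by
    rw [ENNReal.ofReal_div_of_pos hT0]
    have hT1 : ENNReal.ofReal T ≠ 0 := (ENNReal.ofReal_pos.2 hT0).ne'
    rw [ENNReal.div_lt_iff (Or.inl hT1) (Or.inl ENNReal.ofReal_ne_top)]
    have hne : asymptoticGap lam I ≠ 0 := by
      have : gap lam I ≤ asymptoticGap lam I := by
        refine le_iSup_of_le ∅ (le_iSup_of_le (empty_subset _) (le_iSup_of_le finite_empty ?_))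
        rw [sdiff_empty]
      exact (hgap.trans_le this).ne'
    rw [ENNReal.div_lt_iff (Or.inl hne) (Or.inr ENNReal.ofReal_ne_top)] at hT
    rwa [mul_comm (asymptoticGap lam I)]
  simp only [asymptoticGap, lt_iSup_iff] at hlt
  obtain ⟨S, _, hSfin, hS⟩ := hlt
  obtain ⟨g, hg1, hg2⟩ := ENNReal.lt_iff_exists_nnreal_btwn.1 hS
  have hg : 2 * π / T < (g : ℝ) := by
    rw [← ENNReal.ofReal_coe_nnreal] at hg1
    exact ENNReal.ofReal_lt_ofReal_iff_of_nonneg (by positivity) |>.1 hg1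
  refine ⟨(hSfin.image lam).toFinset, g, (by positivity : (0 : ℝ) < 2 * π / T).trans hg, ?_,
    (div_lt_iff₀ hT0).1 hg⟩
  have hsep : IsSeparatedBy (lam '' (I \ S)) (g : ℝ) :=
    isSeparatedBy_image_of_lt_gap (by rw [ENNReal.ofReal_coe_nnreal]; exact hg2.le)
  refine hsep.mono ?_
  rw [hrange, Finite.coe_toFinset]
  rintro _ ⟨⟨k, hk, rfl⟩, hkS⟩
  exact ⟨k, ⟨hk, fun h => hkS (mem_image_of_mem _ h)⟩, rfl⟩

lemma finite_len_lt (N : ℝ) : {k : ℤ × ℤ | len k < N}.Finite := by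
  have hbd : ∀ (n : ℤ), |(n : ℝ)| < N → n ∈ Icc (-⌈N⌉) ⌈N⌉ := by
    intro n hn
    have h := abs_lt.1 hn
    have h1 := Int.le_ceil N
    constructor
    · exact_mod_cast (by push_cast; linarith : ((-⌈N⌉ : ℤ) : ℝ) ≤ n)
    · exact_mod_cast (by linarith : (n : ℝ) ≤ ⌈N⌉)
  refine ((finite_Icc (-⌈N⌉) ⌈N⌉).prod (finite_Icc (-⌈N⌉) ⌈N⌉)).subset fun k hk => ?_
  have hk' : len k < N := hk
  refine ⟨hbd _ (lt_of_le_of_lt ?_ hk'), hbd _ (lt_of_le_of_lt ?_ hk')⟩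
  · exact Real.abs_le_sqrt (le_add_of_nonneg_right (sq_nonneg _))
  · exact Real.abs_le_sqrt (le_add_of_nonneg_left (sq_nonneg _))

/-- The order bound says nothing for `|k| < N₀`; these finitely many modes are absorbed into the
constant. The factor `k₁` raises the order from `r - 1` to `r`. -/
lemma HasOrder.exists_growth {b : ℤ × ℤ → ℝ} {r : ℝ} (hr : 1 ≤ r) (hb : HasOrder b r) :
    ∃ C, 0 ≤ C ∧ ∀ k : ℤ × ℤ, |k.1 * b k| ≤ C * (1 + len k) ^ r := by
  obtain ⟨C, hC, N₀, -, hCb⟩ := hb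
  obtain ⟨B, hB⟩ := ((finite_len_lt N₀).image fun k => |k.1 * b k|).bddAbove
  refine ⟨max C B, le_max_of_le_left hC.le, fun k => ?_⟩
  have h1 : 1 ≤ 1 + len k := le_add_of_nonneg_right (len_nonneg k)
  rcases lt_or_ge (len k) N₀ with h | h
  · calc |k.1 * b k| ≤ B := hB (mem_image_of_mem _ h)
      _ ≤ max C B := le_max_right _ _
      _ ≤ max C B * (1 + len k) ^ r := le_mul_of_one_le_right (le_max_of_le_left hC.le)
        (Real.one_le_rpow h1 (by linarith))
  · have hk1 : |(k.1 : ℝ)| ≤ 1 + len k :=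
      (Real.abs_le_sqrt (le_add_of_nonneg_right (sq_nonneg _))).trans
        (le_add_of_nonneg_left zero_le_one)
    have h2 : len k ^ (r - 1) ≤ (1 + len k) ^ (r - 1) :=
      Real.rpow_le_rpow (len_nonneg k) (by linarith) (by linarith)
    rw [abs_mul]
    calc |(k.1 : ℝ)| * |b k| ≤ (1 + len k) * (C * (1 + len k) ^ (r - 1)) := by
          refine mul_le_mul hk1 ((hCb k h).trans ?_) (abs_nonneg _) (one_add_len_pos k).le
          gcongr
      _ = C * (1 + len k) ^ r := by
          rw [mul_left_comm, ← Real.rpow_one_add' (one_add_len_pos k).le (by linarith)]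
          congr 2
          ring
      _ ≤ _ := mul_le_mul_of_nonneg_right (le_max_left _ _)
        (Real.rpow_nonneg (one_add_len_pos k).le _)

/-! ### Uniqueness -/

lemma _root_.AbsolutelyContinuousOnInterval.clm_comp {E F : Type*} [NormedAddCommGroup E]
    [NormedSpace ℂ E] [NormedAddCommGroup F] [NormedSpace ℂ F] {f : ℝ → E} {a b : ℝ}
    (hf : AbsolutelyContinuousOnInterval f a b) (L : E →L[ℂ] F) :
    AbsolutelyContinuousOnInterval (fun x => L (f x)) a b := by
  refine squeeze_zero (fun t => Finset.sum_nonneg fun i _ => dist_nonneg) (fun t => ?_)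
    (by simpa using Filter.Tendsto.const_mul ‖L‖ hf)
  rw [Finset.mul_sum]
  exact Finset.sum_le_sum fun i _ => L.lipschitz.dist_le_mul _ _

/-- In the difference of two solutions the control term cancels. Each coefficient times `e^{-iλ_k
t}` is absolutely continuous with derivative zero almost everywhere, hence constant, and it starts
at zero. -/
lemma IsSolution.eqOn {b : ℤ × ℤ → ℝ} {g₁ g₂ : Torus → ℝ} {s r : ℝ} {hr : 1 ≤ r} {T : ℝ}
    (hT : 0 ≤ T) {u₀ : Sobolev s} {h u v : ℝ → Sobolev s} (hu : IsSolution b g₁ g₂ hr T u₀ h u)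
    (hv : IsSolution b g₁ g₂ hr T u₀ h v) : EqOn v u (Icc 0 T) := by
  have hle : s - r ≤ s := sub_le_self s (zero_le_one.trans hr)
  intro t ht
  ext k
  set c : ℂ := Complex.I * (k.1 * b k : ℝ) with hc
  let e : ℝ → ℂ := fun t => Complex.exp (-(c * t))
  have he : ∀ t, HasDerivAt e (e t * -(c * 1)) t := fun t =>
    (((Complex.ofRealCLM.hasDerivAt (x := t)).const_mul c).neg).cexp
  have heac : AbsolutelyContinuousOnInterval e 0 T :=
    absolutelyContinuousOnInterval_of_hasDerivAt (by fun_prop) he 0 T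
  let δ : ℝ → ℂ := fun t => coeffCLM (s - r) k ((v t).incl hle - (u t).incl hle)
  have hδac : AbsolutelyContinuousOnInterval δ 0 T :=
    (hv.absolutelyContinuous.sub hu.absolutelyContinuous).clm_comp (coeffCLM (s - r) k)
  have hac : AbsolutelyContinuousOnInterval (fun t => e t • δ t) 0 T := heac.fun_smul hδac
  have hder : ∀ᵐ x, x ∈ uIcc 0 T → HasDerivAt (fun t => e t • δ t) 0 x := by
    have h1 := (ae_restrict_iff' measurableSet_Ioo).1 hu.equation
    have h2 := (ae_restrict_iff' measurableSet_Ioo).1 hv.equation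
    filter_upwards [h1, h2, Measure.ae_ne volume (0 : ℝ), Measure.ae_ne volume T] with x hx1 hx2 hx0 hxT hx
    rw [uIcc_of_le hT] at hx
    have hxm : x ∈ Ioo 0 T := ⟨lt_of_le_of_ne hx.1 (Ne.symm hx0), lt_of_le_of_ne hx.2 hxT⟩
    obtain ⟨d₁, hd₁, hc₁⟩ := hx1 hxm
    obtain ⟨d₂, hd₂, hc₂⟩ := hx2 hxm
    have hδ : HasDerivAt δ (coeffCLM (s - r) k (d₂ - d₁)) x :=
      ((coeffCLM (s - r) k).restrictScalars ℝ).hasFDerivAt.comp_hasDerivAt x (hd₂.sub hd₁)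
    refine ((he x).smul hδ).congr_deriv ?_
    have hval : coeffCLM (s - r) k (d₂ - d₁) = c * δ x := by
      simp only [δ, coeffCLM_apply, coeff_sub, coeff_incl]
      rw [hc₁, hc₂, hc]
      simp only [Pi.add_apply, derivX, multiplier]
      push_cast
      ring
    rw [hval]
    simp only [smul_eq_mul]
    ring
  obtain ⟨C, hC⟩ := hac.const_of_ae_hasDerivAt_zero hder
  have h0 := hC 0 left_mem_uIcc
  have ht' := hC t (by rwa [uIcc_of_le hT])
  have hδ0 : δ 0 = 0 := by
    simp only [δ, hu.initial, hv.initial, sub_self, map_zero]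
  rw [hδ0, smul_zero] at h0
  rw [← h0, smul_eq_mul, mul_eq_zero] at ht'
  have hδt := ht'.resolve_left (Complex.exp_ne_zero _)
  simp only [δ, coeffCLM_apply, coeff_sub, coeff_incl] at hδt
  exact sub_eq_zero.1 hδt

/-! ### Construction of the control -/

lemma eLpNorm_two_restrict_Icc_le {E : Type*} [NormedAddCommGroup E] {h : ℝ → E} {T C : ℝ}
    (hC : ∀ t, ‖h t‖ ≤ C) :
    eLpNorm h 2 (volume.restrict (Icc 0 T)) ≤ ENNReal.ofReal (Real.sqrt T * C) := by
  refine (eLpNorm_le_of_ae_bound (Filter.Eventually.of_forall hC)).trans (le_of_eq ?_)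
  rw [Measure.restrict_apply_univ, Real.volume_Icc, sub_zero, ENNReal.ofReal_mul (Real.sqrt_nonneg _),
    Real.sqrt_eq_rpow, ENNReal.toReal_ofNat, ← one_div]
  congr 1
  rcases le_total 0 T with hT | hT
  · rw [ENNReal.ofReal_rpow_of_nonneg hT (by norm_num)]
  · rw [ENNReal.ofReal_of_nonpos hT, ← Real.sqrt_eq_rpow, Real.sqrt_eq_zero_of_nonpos hT,
      ENNReal.zero_rpow_of_pos (by norm_num), ENNReal.ofReal_zero]

/-- Integrating a control built from biorthogonal functions against an exponential isolates one
eigenspace. -/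
lemma coeff_integral_biorthogonal {s T M : ℝ} (hT : 0 ≤ T) {lam : ℤ × ℤ → ℝ}
    {Q : ℤ × ℤ → ℝ → ℂ} (hQ : ∀ j, IsControlShape T M (Q j))
    (hbi : ∀ j k, expTransform (Q j) (lam k) = if lam k = lam j then 1 else 0)
    {v : Sobolev s} {h : ℝ → Sobolev s} (hh : Continuous h)
    (hcoef : ∀ t j, (h t).coeff j = Q j t * v.coeff j) (k j : ℤ × ℤ) :
    (∫ τ in (0 : ℝ)..T, Complex.exp (-(Complex.I * lam k * τ)) • h τ).coeff j
      = if lam k = lam j then v.coeff j else 0 := by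
  have hc : Continuous fun τ : ℝ => Complex.exp (-(Complex.I * lam k * τ)) • h τ := by fun_prop
  rw [← coeffCLM_apply,
    ← ContinuousLinearMap.intervalIntegral_comp_comm _ (hc.intervalIntegrable _ _)]
  simp only [coeffCLM_apply, coeff_smul, hcoef]
  have h1 : ∀ τ : ℝ, Complex.exp (-(Complex.I * lam k * τ)) * (Q j τ * v.coeff j)
      = Q j τ * Complex.exp (-(Complex.I * lam k * τ)) * v.coeff j := fun τ => by ring
  simp_rw [h1]
  rw [intervalIntegral.integral_mul_const, ← integral_eq_intervalIntegral_of_support hT]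
  · have h2 := hbi j k
    rw [expTransform] at h2
    rw [h2]
    split_ifs <;> simp
  · intro t ht
    rw [(hQ j).support t ht, zero_mul]

end TorusControl

end

/-! ### Exact controllability -/

open TorusControl
theorem theorem1p2 (s r : ℝ) (hs : 0 ≤ s) (hr : 1 ≤ r)
    (b lam : ℤ × ℤ → ℝ) (hb : HasOrder b r)
    (h1 : EigenvalueHyp b lam) (h3 : OddEvenHyp lam)
    (I : Set (ℤ × ℤ)) (hI : IsMaximalDistinct lam I) (hgap : 0 < gap lam I)
    (T : ℝ) (hT : ENNReal.ofReal (2 * Real.pi) / asymptoticGap lam I < ENNReal.ofReal T) :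
    ∃ ν : ℝ, 0 < ν ∧
      ∀ g₁ g₂ : Torus → ℝ, IsProfile g₁ → IsProfile g₂ →
      ∀ u₀ u₁ : Sobolev s, u₀.coeff (0, 0) = u₁.coeff (0, 0) →
      ∃ h : ℝ → Sobolev s,
        MemLp h 2 (volume.restrict (Icc 0 T)) ∧
        (∃ u : ℝ → Sobolev s, IsSolution b g₁ g₂ hr T u₀ h u ∧
          (∀ v : ℝ → Sobolev s, IsSolution b g₁ g₂ hr T u₀ h v → EqOn v u (Icc 0 T)) ∧
          u T = u₁) ∧
        eLpNorm h 2 (volume.restrict (Icc 0 T)) ≤ ENNReal.ofReal (ν * (‖u₀‖ + ‖u₁‖)) := by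
  have hT0 : 0 < T := ENNReal.ofReal_pos.1 (pos_of_gt hT)
  have hlam : ∀ k, lam k = k.1 * b k := fun k => (h1 k).1
  have hlam0 : lam (0, 0) = 0 := by rw [hlam]; simp
  obtain ⟨C, hC0, hC⟩ := hb.exists_growth hr
  simp only [← hlam] at hC
  obtain ⟨γ, hγ, hsep, F, g, hg, hF, hgT⟩ := exists_separation hI hgap hT
  obtain ⟨M₀, hM₀⟩ := exists_uniform_biorthogonal hγ hsep F hg hF hgT
  choose q hq hqt using hM₀
  -- The maximum only serves to make `M`, and hence `ν`, positive.
  set M : ℝ := max M₀ 1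
  have hM : 0 < M := zero_lt_one.trans_le (le_max_right _ _)
  -- Indices with equal eigenvalues share one function, so whole eigenspaces are isolated, even
  -- infinite-dimensional ones.
  set Q : ℤ × ℤ → ℝ → ℂ := fun k => q (lam k) (mem_range_self k) with hQdef
  have hQ : ∀ k, IsControlShape T M (Q k) := fun k =>
    (hq (lam k) (mem_range_self k)).mono le_rfl (le_max_left _ _)
  have hbi : ∀ j k, expTransform (Q j) (lam k) = if lam k = lam j then 1 else 0 := fun j k =>
    hqt (lam j) (mem_range_self j) (lam k) (mem_range_self k)
  have hsT : 0 < Real.sqrt T := Real.sqrt_pos.2 hT0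
  -- The factors come from passing from the supremum in time to `L²`, from the biorthogonal family
  -- and from the block inverse. The constant is fixed before the profiles are introduced.
  refine ⟨Real.sqrt T * (M * (2 * (2 * Real.pi) ^ 2)), by positivity,
    fun g₁ g₂ hg₁ hg₂ u₀ u₁ h01 => ?_⟩
  obtain ⟨G, hG⟩ := exists_controlOp hs hg₁ hg₂
  have hexp : ∀ k, ‖Complex.exp (-(Complex.I * lam k * T))‖ ≤ 1 := fun k =>
    (norm_exp_neg_I_mul _ _).le
  -- The target for the moments: the final state carried back to time `0` by the free group, minus
  -- the initial state.
  set z : Sobolev s := Sobolev.diag (fun k => Complex.exp (-(Complex.I * lam k * T))) 1 zero_le_one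
    hexp u₁ - u₀ with hz
  have hzk : ∀ k, z.coeff k = Complex.exp (-(Complex.I * lam k * T)) * u₁.coeff k - u₀.coeff k := by
    intro k
    rw [hz, Sobolev.coeff_sub, Sobolev.coeff_diag]
  have hzn : ‖z‖ ≤ ‖u₀‖ + ‖u₁‖ := by
    refine (norm_sub_le _ _).trans ?_
    have := Sobolev.norm_diag_apply_le (hM := zero_le_one) (hm := hexp) u₁
    linarith
  obtain ⟨v, hvn, hv⟩ := exists_block_inverse (β := fun n => 2 * Real.pi * profileCoef g₂ (2 * n))
    (fun n => by
      have h2 := hg₂.norm_profileCoef_le (2 * n)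
      have h3 : ‖(2 * Real.pi : ℂ)‖ = 2 * Real.pi := by
        rw [show (2 * Real.pi : ℂ) = ((2 * Real.pi : ℝ) : ℂ) by push_cast; rfl, Complex.norm_real,
          Real.norm_of_nonneg Real.two_pi_pos.le]
      rw [norm_mul, h3]
      rwa [le_div_iff₀' Real.two_pi_pos] at h2) z
  obtain ⟨h, hh, hcoef⟩ := Sobolev.exists_continuous_diag (m := fun t k => Q k t) hM.le
    (fun t k => (hQ k).bound t) (fun k => (hQ k).continuous) (continuous_const (y := v))
  have hhn : ∀ t, ‖h t‖ ≤ M * (2 * (2 * Real.pi) ^ 2 * (‖u₀‖ + ‖u₁‖)) := by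
    intro t
    have h5 : ‖h t‖ ≤ M * ‖v‖ := Sobolev.norm_le_of_coeff_eq Function.injective_id hM.le
      (fun k => mul_le_mul_of_nonneg_right ((hQ k).bound t)
        (Real.rpow_nonneg (one_add_len_pos k).le _)) (hcoef t)
    refine h5.trans (mul_le_mul_of_nonneg_left (hvn.trans ?_) hM.le)
    exact mul_le_mul_of_nonneg_left hzn (by positivity)
  have hLp := eLpNorm_two_restrict_Icc_le (T := T) hhn
  have hGh : Continuous fun t => G (h t) := G.continuous.comp hh
  obtain ⟨u, d, hu, hd, hu0, hud, hdc, huc⟩ := exists_duhamel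
    (sub_le_self s (zero_le_one.trans hr)) hC0 hC hGh u₀
  have hsol : IsSolution b g₁ g₂ hr T u₀ h u := by
    refine ⟨hu.continuousOn, hu0, absolutelyContinuousOnInterval_of_hasDerivAt hd hud 0 T,
      Filter.Eventually.of_forall fun t => ⟨d t, hud t, ?_⟩⟩
    funext k
    rw [hdc, Pi.add_apply, hG, hlam]
    simp only [derivX, multiplier]
    push_cast
    ring
  refine ⟨h, ⟨hh.aestronglyMeasurable, hLp.trans_lt ENNReal.ofReal_lt_top⟩,
    ⟨u, hsol, fun w hw => hsol.eqOn hT0.le hw, ?_⟩, ?_⟩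
  · ext k
    -- The moment identity. `G` acts only in space, so it commutes with the time integral and meets
    -- the projection `w` of `v` onto the eigenspace of `λ_k`.
    have hint : ∫ τ in (0 : ℝ)..T, Complex.exp (-(Complex.I * lam k * τ)) * (G (h τ)).coeff k
        = z.coeff k := by
      by_cases hk : k = (0, 0)
      · subst hk
        simp only [hG, fourierCoef_opG_zero hs hg₁ hg₂, mul_zero, intervalIntegral.integral_zero, hzk,
          hlam0, h01]
        simp
      set w : Sobolev s := ∫ τ in (0 : ℝ)..T, Complex.exp (-(Complex.I * lam k * τ)) • h τ with hw
      have hwc := fun j => coeff_integral_biorthogonal hT0.le hQ hbi hh hcoef k j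
      rw [← hw] at hwc
      have hc : Continuous fun τ : ℝ => Complex.exp (-(Complex.I * lam k * τ)) • h τ := by fun_prop
      have hGw : ∫ τ in (0 : ℝ)..T, Complex.exp (-(Complex.I * lam k * τ)) * (G (h τ)).coeff k
          = (G w).coeff k := by
        have h6 := ((Sobolev.coeffCLM s k).comp G).intervalIntegral_comp_comm
          (hc.intervalIntegrable (μ := volume) 0 T)
        simp only [ContinuousLinearMap.comp_apply, Sobolev.coeffCLM_apply, map_smul] at h6
        exact h6
      -- The reflected index lies in the same eigenspace, so `w` agrees with `v` at both indices of
      -- the block.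
      have hflip : lam k = lam (flipSnd k) := (h3.even_snd k.1 k.2).symm
      rw [hGw, hG, fourierCoef_opG_of_eigen hs h3 hg₁ hg₂ k w
        (fun j hj => by rw [hwc, if_neg (Ne.symm hj)]), hwc, hwc, if_pos rfl, if_pos hflip]
      exact hv k hk
    have hee : Complex.exp (Complex.I * lam k * T) * Complex.exp (-(Complex.I * lam k * T)) = 1 := by
      rw [← Complex.exp_add, add_neg_cancel, Complex.exp_zero]
    rw [huc, hint, hzk]
    linear_combination u₁.coeff k * hee
  · refine hLp.trans (ENNReal.ofReal_le_ofReal (le_of_eq ?_))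
    ring
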